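/- Let $k$ be a commutative ring and let $\mathcal{A}=(A=\bigoplus_{i\in\mathbb{Z}}A^i,d)$ be a differential graded (dg) $k$-algebra such that $A^i=0$ for $i<0$, the ring $A^0$ is semisimple, and $d(A^0)=0$. Put $A^+=\bigoplus_{i>0}A^i$. All dg modules are right dg modules over $\mathcal{A}$; $\mathrm{dgMod}$ is the category of dg modules (morphisms are $A$-linear of degree $0$ and commute with $d$), $\mathrm{dgHot}$ its homotopy category, and $\{n\}$ is the shift, $(\{n\}M)^i=M^{i+n}$, $d_{\{n\}M}=(-1)^n d_M$. Let $\mathrm{dgPer}\subset\mathrm{dgHot}$ be the smallest strict full triangulated subcategory that contains $\mathcal{A}$ and is closed under direct summands. For a dg module $M$ let $\overline M=M/MA^+=M\otimes_A A^0$ with the induced differential, $H(\overline M)$ its cohomology, and $M_{\le i}=\sum_{j\le i}M^jA$; $\lambda$ denotes the length (in $\mathbb{N}\cup\{\infty\}$) of a right $A^0$-module. For a simple right $A^0$-module $L$, placed in degree $0$, let $\hat L=L\otimes_{A^0}A$ with differential $l\otimes a\mapsto l\otimes d(a)$. Let $\mathrm{dgFilt}$ be the class of dg modules $M$ that have a finite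 filtration $0=F_0\subset F_1\subset\dots\subset F_n=M$ by dg submodules with $F_i/F_{i-1}\cong\{l_i\}\hat L_i$ in $\mathrm{dgMod}$ for simple right $A^0$-modules $L_i$ and integers $l_1\ge l_2\ge\dots\ge l_n$. A dg module $M$ is homotopically minimal if every endomorphism of $M$ in $\mathrm{dgMod}$ that is a homotopy equivalence is an isomorphism. A dg module $M$ is bounded below if $M^i=0$ for all $i\ll 0$. Let $M$ be in $\mathrm{dgPer}$ and consider the conditions: 1. $M$ is in $\mathrm{dgFilt}$; 2. $M$ is homotopically minimal; 3. $d(M_{\le i})\subset M_{\le i}$ for all $i\in\mathbb{Z}$; 4. $d(M)\subset MA^+$; 5. $\overline M$ has differential $0$; 6. $\lambda(\overline M)=\lambda(H(\overline M))$; 7. $\lambda(\overline M)$ is finite, and $\lambda(\overline M)\le\lambda(\overline N)$ for every dg module $N$ isomorphic to $M$ in $\mathrm{dgHot}$. Then: - if $M$ is bounded below, the conditions 1–7 are equivalent; - for every $M$ in $\mathrm{dgPer}$, bounded below or not, 1 and 2 are equivalent, 3–7 are equivalent, and 1 implies that $M$ is bounded below and that 3 holds. -/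

import Mathlib

open scoped TensorProduct DirectSum

universe w u

noncomputable section

/-! ### Differential graded algebras and right differential graded modules -/

/-- A differential graded `k`-algebra structure on the `k`-algebra `A`: a `ℤ`-grading
`A = ⨁ i, A^i` as an algebra and a `k`-linear differential of degree one which satisfies the
graded Leibniz rule `d(ab) = d(a) b + (-1)^i a d(b)` for `a ∈ A^i`. -/
structure DGAlgebra (k : Type w) (A : Type u) [CommRing k] [Ring A] [Algebra k A] where
  gr : ℤ → Submodule k A
  graded : GradedAlgebra gr
  d : A →ₗ[k] A
  d_mem : ∀ (i : ℤ) (a : A), a ∈ gr i → d a ∈ gr (i + 1)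
  d_d : ∀ a : A, d (d a) = 0
  leibniz : ∀ (i : ℤ) (a b : A), a ∈ gr i → d (a * b) = d a * b + i.negOnePow • (a * d b)

attribute [instance] DGAlgebra.graded

variable {k : Type w} {A : Type u} [CommRing k] [Ring A] [Algebra k A]

/-- The degree zero part `A^0`, a subring of `A`. -/
def DGAlgebra.A0 (𝒜 : DGAlgebra k A) : Type u := ↥(SetLike.GradeZero.subring 𝒜.gr)

instance (𝒜 : DGAlgebra k A) : Ring 𝒜.A0 :=
  inferInstanceAs (Ring ↥(SetLike.GradeZero.subring 𝒜.gr))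

/-- The inclusion of rings `A^0 → A`. -/
def DGAlgebra.A0incl (𝒜 : DGAlgebra k A) : 𝒜.A0 →+* A :=
  (SetLike.GradeZero.subring 𝒜.gr).subtype

theorem DGAlgebra.A0incl_mem (𝒜 : DGAlgebra k A) (r : 𝒜.A0) : 𝒜.A0incl r ∈ 𝒜.gr 0 :=
  r.2

/-- A (right) dg module over `𝒜`. Right modules over `A` are modules over `Aᵐᵒᵖ`, so that
`MulOpposite.op a • m` is the product `m a`. The differential satisfies
`d(ma) = d(m) a + (-1)^i m d(a)` for `m ∈ M^i`. -/
structure DGModule (𝒜 : DGAlgebra k A) where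
  carrier : Type u
  [addCommGroup : AddCommGroup carrier]
  [module : Module Aᵐᵒᵖ carrier]
  gr : ℤ → AddSubgroup carrier
  internal : DirectSum.IsInternal gr
  smul_mem : ∀ (i j : ℤ) (m : carrier) (a : A), m ∈ gr i → a ∈ 𝒜.gr j →
    MulOpposite.op a • m ∈ gr (i + j)
  d : carrier →+ carrier
  d_mem : ∀ (i : ℤ) (m : carrier), m ∈ gr i → d m ∈ gr (i + 1)
  d_d : ∀ m : carrier, d (d m) = 0
  leibniz : ∀ (i : ℤ) (m : carrier) (a : A), m ∈ gr i →
    d (MulOpposite.op a • m) =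
      MulOpposite.op a • d m + i.negOnePow • (MulOpposite.op (𝒜.d a) • m)

attribute [instance] DGModule.addCommGroup DGModule.module

/-- A criterion for an internal grading: there are projections to the pieces. -/
theorem DGModule.isInternal_of_proj {X : Type*} [AddCommGroup X] (gr : ℤ → AddSubgroup X)
    (p : ℤ → X →+ X) (hsame : ∀ i, ∀ x ∈ gr i, p i x = x)
    (hne : ∀ i j, i ≠ j → ∀ x ∈ gr i, p j x = 0) (htop : ∀ x, x ∈ ⨆ i, gr i) :
    DirectSum.IsInternal gr := by
  have key : ∀ (x : ⨁ i, gr i) (j : ℤ), p j (DirectSum.coeAddMonoidHom gr x) = x j := by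
    intro x j
    induction x using DirectSum.induction_on with
    | zero => simp
    | of i y =>
      rw [DirectSum.coeAddMonoidHom_of]
      by_cases h : i = j
      · subst h
        rw [hsame _ _ y.2, DirectSum.of_eq_same]
      · rw [hne i j h _ y.2, DirectSum.of_eq_of_ne _ _ _ (Ne.symm h)]
        rfl
    | add x y hx hy => simp [hx, hy]
  constructor
  · refine (injective_iff_map_eq_zero (DirectSum.coeAddMonoidHom gr)).2 fun x hx => ?_
    refine DFinsupp.ext fun j => Subtype.ext ?_
    have := key x j
    rw [hx, map_zero] at this
    exact this.symm
  · intro x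
    have h : (⨆ i, gr i) ≤ (DirectSum.coeAddMonoidHom gr).range := by
      refine iSup_le fun i y hy => ?_
      exact ⟨DirectSum.of (fun i => gr i) i ⟨y, hy⟩, DirectSum.coeAddMonoidHom_of gr i ⟨y, hy⟩⟩
    exact h (htop x)

namespace DGAlgebra

variable (𝒜 : DGAlgebra k A)

/-- The projection of `A` to its homogeneous component of degree `i`. -/
def proj (i : ℤ) : A →+ A where
  toFun a := (DirectSum.decompose 𝒜.gr a i : A)
  map_zero' := by simp
  map_add' := by simp

theorem proj_same {i : ℤ} {a : A} (h : a ∈ 𝒜.gr i) : 𝒜.proj i a = a :=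
  DirectSum.decompose_of_mem_same _ h

theorem proj_ne {i j : ℤ} (hij : i ≠ j) {a : A} (h : a ∈ 𝒜.gr i) : 𝒜.proj j a = 0 :=
  DirectSum.decompose_of_mem_ne _ h hij

theorem induction {P : A → Prop} (h0 : P 0) (hom : ∀ i, ∀ a ∈ 𝒜.gr i, P a)
    (add : ∀ a b, P a → P b → P (a + b)) (a : A) : P a :=
  DirectSum.Decomposition.inductionOn 𝒜.gr h0 (fun m => hom _ m m.2) add a

end DGAlgebra

namespace DGModule

variable {𝒜 : DGAlgebra k A}

/-- The projection of `M` to its homogeneous component of degree `i`. -/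
def proj (M : DGModule 𝒜) (i : ℤ) : M.carrier →+ M.carrier :=
  letI := M.internal.chooseDecomposition
  { toFun := fun m => (DirectSum.decompose M.gr m i : M.carrier)
    map_zero' := by simp
    map_add' := by simp }

theorem proj_same (M : DGModule 𝒜) {i : ℤ} {m : M.carrier} (h : m ∈ M.gr i) :
    M.proj i m = m :=
  let _ := M.internal.chooseDecomposition
  DirectSum.decompose_of_mem_same _ h

theorem proj_ne (M : DGModule 𝒜) {i j : ℤ} (hij : i ≠ j) {m : M.carrier} (h : m ∈ M.gr i) :
    M.proj j m = 0 :=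
  let _ := M.internal.chooseDecomposition
  DirectSum.decompose_of_mem_ne _ h hij

theorem proj_mem (M : DGModule 𝒜) (i : ℤ) (m : M.carrier) : M.proj i m ∈ M.gr i :=
  letI := M.internal.chooseDecomposition
  (DirectSum.decompose M.gr m i).2

theorem exists_sum_proj (M : DGModule 𝒜) (m : M.carrier) :
    ∃ s : Finset ℤ, ∑ i ∈ s, M.proj i m = m := by
  classical
  letI := M.internal.chooseDecomposition
  exact ⟨_, DirectSum.sum_support_decompose M.gr m⟩

theorem induction (M : DGModule 𝒜) {P : M.carrier → Prop} (h0 : P 0)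
    (hom : ∀ i, ∀ m ∈ M.gr i, P m) (add : ∀ a b, P a → P b → P (a + b)) (m : M.carrier) : P m :=
  letI := M.internal.chooseDecomposition
  DirectSum.Decomposition.inductionOn M.gr h0 (fun m => hom _ m m.2) add m

/-- Every right `A`-module is a right `A^0`-module by restriction. -/
instance (M : DGModule 𝒜) : Module 𝒜.A0ᵐᵒᵖ M.carrier :=
  Module.compHom M.carrier (RingHom.op 𝒜.A0incl)

theorem A0_smul_def (M : DGModule 𝒜) (r : 𝒜.A0ᵐᵒᵖ) (m : M.carrier) :
    r • m = MulOpposite.op (𝒜.A0incl r.unop) • m := rfl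

/-- `M^i = 0` for `i ≪ 0`. -/
def IsBoundedBelow (M : DGModule 𝒜) : Prop := ∃ n : ℤ, ∀ i < n, M.gr i = ⊥

/-! ### Basic constructions -/

/-- `𝒜` as a dg module over itself. -/
def regular (𝒜 : DGAlgebra k A) : DGModule 𝒜 where
  carrier := A
  gr i := (𝒜.gr i).toAddSubgroup
  internal := isInternal_of_proj _ 𝒜.proj (fun _ _ h => 𝒜.proj_same h)
    (fun _ _ hij _ h => 𝒜.proj_ne hij h)
    (𝒜.induction (zero_mem _)
      (fun i m hm => AddSubgroup.mem_iSup_of_mem (S := fun i => (𝒜.gr i).toAddSubgroup) i hm)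
      (fun _ _ => add_mem))
  smul_mem i j m a hm ha :=
    (SetLike.mul_mem_graded (A := 𝒜.gr) hm ha : m * a ∈ 𝒜.gr (i + j))
  d := 𝒜.d.toAddMonoidHom
  d_mem := 𝒜.d_mem
  d_d := 𝒜.d_d
  leibniz := 𝒜.leibniz

/-- The shift `{n}M`, with `({n}M)^i = M^{i+n}` and differential `(-1)^n d`. -/
def shift (n : ℤ) (M : DGModule 𝒜) : DGModule 𝒜 where
  carrier := M.carrier
  gr i := M.gr (i + n)
  internal := isInternal_of_proj _ (fun i => M.proj (i + n)) (fun _ _ h => M.proj_same h)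
    (fun _ _ hij _ h => M.proj_ne (by omega) h)
    (M.induction (zero_mem _)
      (fun i m hm => AddSubgroup.mem_iSup_of_mem (S := fun i => M.gr (i + n)) (i - n)
        (by simpa using hm))
      (fun _ _ => add_mem))
  smul_mem i j m a hm ha := by
    have := M.smul_mem _ _ m a hm ha
    rwa [show i + n + j = i + j + n by ring] at this
  d := n.negOnePow • M.d
  d_mem i m hm := by
    have := M.d_mem _ m hm
    rw [show i + n + 1 = i + 1 + n by ring] at this
    rcases Int.units_eq_one_or n.negOnePow with h | h <;> simpa [h] using this
  d_d m := by
    rcases Int.units_eq_one_or n.negOnePow with h | h <;> simp [h, M.d_d]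
  leibniz i m a hm := by
    have := M.leibniz _ m a hm
    rw [Int.negOnePow_add] at this
    rcases Int.units_eq_one_or n.negOnePow with h | h <;> simp [h, this] <;> abel

/-- The direct sum `M ⊕ N`. -/
def prod (M N : DGModule 𝒜) : DGModule 𝒜 where
  carrier := M.carrier × N.carrier
  gr i := (M.gr i).prod (N.gr i)
  internal := isInternal_of_proj _ (fun i => (M.proj i).prodMap (N.proj i))
    (fun _ _ h => Prod.ext (M.proj_same h.1) (N.proj_same h.2))
    (fun _ _ hij _ h => Prod.ext (M.proj_ne hij h.1) (N.proj_ne hij h.2))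
    (fun x => by
      have h1 : ∀ m : M.carrier, (m, (0 : N.carrier)) ∈ ⨆ i, (M.gr i).prod (N.gr i) :=
        M.induction (zero_mem _)
          (fun i m hm => AddSubgroup.mem_iSup_of_mem (S := fun i => (M.gr i).prod (N.gr i)) i
            ⟨hm, zero_mem _⟩)
          (fun a b ha hb => by simpa using add_mem ha hb)
      have h2 : ∀ n : N.carrier, ((0 : M.carrier), n) ∈ ⨆ i, (M.gr i).prod (N.gr i) :=
        N.induction (zero_mem _)
          (fun i m hm => AddSubgroup.mem_iSup_of_mem (S := fun i => (M.gr i).prod (N.gr i)) i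
            ⟨zero_mem _, hm⟩)
          (fun a b ha hb => by simpa using add_mem ha hb)
      simpa using add_mem (h1 x.1) (h2 x.2))
  smul_mem i j x a hx ha := ⟨M.smul_mem i j _ a hx.1 ha, N.smul_mem i j _ a hx.2 ha⟩
  d := M.d.prodMap N.d
  d_mem i x hx := ⟨M.d_mem i _ hx.1, N.d_mem i _ hx.2⟩
  d_d x := Prod.ext (M.d_d _) (N.d_d _)
  leibniz i x a hx := Prod.ext (M.leibniz i _ a hx.1) (N.leibniz i _ a hx.2)

/-! ### Morphisms, homotopies and cones -/

/-- A morphism in `dgMod(𝒜)`: an `A`-linear map of degree zero which commutes with the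
differentials. -/
structure Hom (M N : DGModule 𝒜) where
  toLin : M.carrier →ₗ[Aᵐᵒᵖ] N.carrier
  map_mem : ∀ (i : ℤ) (m : M.carrier), m ∈ M.gr i → toLin m ∈ N.gr i
  map_d : ∀ m : M.carrier, toLin (M.d m) = N.d (toLin m)

/-- The identity morphism. -/
def Hom.id (M : DGModule 𝒜) : Hom M M := ⟨LinearMap.id, fun _ _ h => h, fun _ => rfl⟩

/-- `g.comp f` is the composition `M → N → P` of `f` and `g`. -/
def Hom.comp {M N P : DGModule 𝒜} (g : Hom N P) (f : Hom M N) : Hom M P :=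
  ⟨g.toLin.comp f.toLin, fun i m hm => g.map_mem i _ (f.map_mem i m hm), fun m => by
    simp [f.map_d, g.map_d]⟩

/-- `f` is an isomorphism in `dgMod(𝒜)`. -/
def Hom.IsIso {M N : DGModule 𝒜} (f : Hom M N) : Prop :=
  ∃ g : Hom N M, g.comp f = Hom.id M ∧ f.comp g = Hom.id N

/-- `M` and `N` are isomorphic in `dgMod(𝒜)`. -/
def Iso (M N : DGModule 𝒜) : Prop := ∃ f : Hom M N, f.IsIso

/-- `f` and `g` are homotopic: `f - g = d h + h d` for an `A`-linear map `h` of degree `-1`.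
Morphisms in `dgHot(𝒜)` are the homotopy classes of morphisms in `dgMod(𝒜)`. -/
def Homotopic {M N : DGModule 𝒜} (f g : Hom M N) : Prop :=
  ∃ h : M.carrier →ₗ[Aᵐᵒᵖ] N.carrier,
    (∀ (i : ℤ) (m : M.carrier), m ∈ M.gr i → h m ∈ N.gr (i - 1)) ∧
    ∀ m : M.carrier, f.toLin m - g.toLin m = N.d (h m) + h (M.d m)

/-- `f` is a homotopy equivalence, i.e. it becomes an isomorphism in `dgHot(𝒜)`. -/
def Hom.IsHomotopyEquiv {M N : DGModule 𝒜} (f : Hom M N) : Prop :=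
  ∃ g : Hom N M, Homotopic (g.comp f) (Hom.id M) ∧ Homotopic (f.comp g) (Hom.id N)

/-- `M` and `N` are isomorphic in `dgHot(𝒜)`. -/
def HotIso (M N : DGModule 𝒜) : Prop := ∃ f : Hom M N, f.IsHomotopyEquiv

/-- The mapping cone `N ⊕ {1}M` of `f : M → N`, with differential
`(n, m) ↦ (d n + f m, - d m)`. -/
def cone {M N : DGModule 𝒜} (f : Hom M N) : DGModule 𝒜 :=
  let S := prod N (shift 1 M)
  { carrier := N.carrier × M.carrier
    gr := S.gr
    internal := S.internal
    smul_mem := S.smul_mem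
    d :=
      { toFun := fun x => (N.d x.1 + f.toLin x.2, - M.d x.2)
        map_zero' := by simp
        map_add' := fun x y => by
          refine Prod.ext ?_ ?_ <;> simp <;> abel }
    d_mem := fun i x hx => ⟨add_mem (N.d_mem i _ hx.1) (f.map_mem _ _ hx.2),
      (M.gr (i + 1 + 1)).neg_mem (M.d_mem _ _ hx.2)⟩
    d_d := fun x => by
      refine Prod.ext ?_ ?_ <;> simp [N.d_d, M.d_d, f.map_d]
    leibniz := fun i x a hx => by
      have h1 := N.leibniz i x.1 a hx.1
      have h2 := M.leibniz (i + 1) x.2 a hx.2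
      rw [Int.negOnePow_succ] at h2
      refine Prod.ext ?_ ?_
      · simp [h1]; abel
      · simp [h2, Units.neg_smul]; abel }

/-- `dgPer(𝒜)` (inside `dgHot(𝒜)`): the smallest class of dg modules which contains `𝒜`, is closed
under isomorphisms in `dgHot(𝒜)`, under all shifts and under cones of morphisms (so that it is the
class of objects of a strict full triangulated subcategory of `dgHot(𝒜)`), and is closed under
direct summands in `dgHot(𝒜)`. -/
inductive IsPerfect : DGModule 𝒜 → Prop
  | regular : IsPerfect (DGModule.regular 𝒜)
  | iso {M N : DGModule 𝒜} : IsPerfect M → HotIso M N → IsPerfect N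
  | shift (n : ℤ) {M : DGModule 𝒜} : IsPerfect M → IsPerfect (DGModule.shift n M)
  | cone {M N : DGModule 𝒜} (f : Hom M N) :
      IsPerfect M → IsPerfect N → IsPerfect (DGModule.cone f)
  | summand {M N : DGModule 𝒜} : IsPerfect (DGModule.prod M N) → IsPerfect M

/-- `M` is homotopically minimal: every endomorphism in `dgMod(𝒜)` which is a homotopy equivalence
is an isomorphism. -/
def IsHomotopicallyMinimal (M : DGModule 𝒜) : Prop :=
  ∀ f : Hom M M, f.IsHomotopyEquiv → f.IsIso

/-! ### Dg submodules and quotients -/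

/-- A dg submodule: an `A`-submodule which is graded and stable under the differential. -/
structure DGSub (M : DGModule 𝒜) where
  toSubmodule : Submodule Aᵐᵒᵖ M.carrier
  proj_mem : ∀ (i : ℤ), ∀ m ∈ toSubmodule, M.proj i m ∈ toSubmodule
  d_mem : ∀ m ∈ toSubmodule, M.d m ∈ toSubmodule

/-- A dg submodule as a dg module. -/
def DGSub.toDGModule {M : DGModule 𝒜} (S : DGSub M) : DGModule 𝒜 where
  carrier := S.toSubmodule
  gr i := (M.gr i).comap S.toSubmodule.subtype.toAddMonoidHom
  internal := isInternal_of_proj _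
    (fun i => ((M.proj i).comp S.toSubmodule.subtype.toAddMonoidHom).codRestrict
      S.toSubmodule (fun x => S.proj_mem i _ x.2))
    (fun _ _ h => Subtype.ext (M.proj_same h))
    (fun _ _ hij _ h => Subtype.ext (M.proj_ne hij h))
    (fun x => by
      obtain ⟨s, hs⟩ := M.exists_sum_proj x.1
      have : x = ∑ i ∈ s, (⟨M.proj i x.1, S.proj_mem i _ x.2⟩ : S.toSubmodule) := by
        apply Subtype.ext
        simp [hs]
      rw [this]
      exact sum_mem fun i _ => AddSubgroup.mem_iSup_of_mem
        (S := fun i => (M.gr i).comap S.toSubmodule.subtype.toAddMonoidHom) i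
        (M.proj_mem i x.1))
  smul_mem i j m a hm ha := M.smul_mem i j m.1 a hm ha
  d := (M.d.comp S.toSubmodule.subtype.toAddMonoidHom).codRestrict
      S.toSubmodule (fun x => S.d_mem _ x.2)
  d_mem i m hm := M.d_mem i m.1 hm
  d_d m := Subtype.ext (M.d_d m.1)
  leibniz i m a hm := Subtype.ext (by
    have := M.leibniz i m.1 a hm
    rcases Int.units_eq_one_or i.negOnePow with h | h <;> simpa [h] using this)

/-- An additive endomorphism of `X` which preserves the submodule `S` acts on `X ⧸ S`. -/
def quotMap {R X : Type*} [Ring R] [AddCommGroup X] [Module R X] (S : Submodule R X)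
    (p : X →+ X) (hp : ∀ x ∈ S, p x ∈ S) : (X ⧸ S) →+ (X ⧸ S) :=
  QuotientAddGroup.map S.toAddSubgroup S.toAddSubgroup p hp

theorem quotMap_mk {R X : Type*} [Ring R] [AddCommGroup X] [Module R X] (S : Submodule R X)
    (p : X →+ X) (hp : ∀ x ∈ S, p x ∈ S) (x : X) :
    quotMap S p hp (S.mkQ x) = S.mkQ (p x) := rfl

/-- The quotient of a dg module by a dg submodule. -/
def quot (M : DGModule 𝒜) (S : DGSub M) : DGModule 𝒜 where
  carrier := M.carrier ⧸ S.toSubmodule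
  gr i := (M.gr i).map S.toSubmodule.mkQ.toAddMonoidHom
  internal := isInternal_of_proj _
    (fun i => quotMap S.toSubmodule (M.proj i) (S.proj_mem i))
    (by
      rintro i _ ⟨x, hx, rfl⟩
      exact congrArg S.toSubmodule.mkQ (M.proj_same hx))
    (by
      rintro i j hij _ ⟨x, hx, rfl⟩
      exact (congrArg S.toSubmodule.mkQ (M.proj_ne hij hx)).trans (map_zero _))
    (fun x => by
      obtain ⟨m, rfl⟩ := S.toSubmodule.mkQ_surjective x
      refine M.induction (P := fun m => S.toSubmodule.mkQ m ∈
        ⨆ i, (M.gr i).map S.toSubmodule.mkQ.toAddMonoidHom) ?_ ?_ ?_ m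
      · rw [map_zero]; exact zero_mem _
      · exact fun i m hm => AddSubgroup.mem_iSup_of_mem
          (S := fun i => (M.gr i).map S.toSubmodule.mkQ.toAddMonoidHom) i ⟨m, hm, rfl⟩
      · intro a b ha hb
        rw [map_add]
        exact add_mem ha hb)
  smul_mem := by
    rintro i j _ a ⟨m, hm, rfl⟩ ha
    exact ⟨_, M.smul_mem i j m a hm ha, rfl⟩
  d := quotMap S.toSubmodule M.d S.d_mem
  d_mem := by
    rintro i _ ⟨m, hm, rfl⟩
    exact ⟨_, M.d_mem i m hm, rfl⟩
  d_d x := by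
    obtain ⟨m, rfl⟩ := S.toSubmodule.mkQ_surjective x
    rw [quotMap_mk, quotMap_mk, M.d_d, map_zero]
  leibniz := by
    rintro i _ a ⟨m, hm, rfl⟩
    have := congrArg S.toSubmodule.mkQ (M.leibniz i m a hm)
    rcases Int.units_eq_one_or i.negOnePow with h | h
    · simp only [h, one_smul, map_add] at this ⊢
      exact this
    · simp only [h, Units.neg_smul, one_smul, map_add, map_neg] at this ⊢
      exact this

/-- For dg submodules `F` and `G` of `M`, the subquotient `G / (F ∩ G)` (which is `G / F` if
`F ⊆ G`). -/
def subquot {M : DGModule 𝒜} (F G : DGSub M) : DGModule 𝒜 :=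
  G.toDGModule.quot
    { toSubmodule := F.toSubmodule.comap G.toSubmodule.subtype
      proj_mem := fun i m hm => by
        have key : G.toSubmodule.subtype (G.toDGModule.proj i m) =
            M.proj i (G.toSubmodule.subtype m) := by
          refine G.toDGModule.induction (P := fun m =>
            G.toSubmodule.subtype (G.toDGModule.proj i m) =
              M.proj i (G.toSubmodule.subtype m)) ?_ ?_ ?_ m
          · rw [map_zero]; exact (map_zero (M.proj i)).symm
          · intro j m hm
            by_cases hij : j = i
            · subst hij
              rw [proj_same _ hm]; exact (M.proj_same hm).symm
            · rw [proj_ne _ hij hm]; exact (M.proj_ne hij hm).symm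
          · intro a b ha hb
            rw [map_add]
            exact (congrArg₂ (· + ·) ha hb).trans (map_add (M.proj i) a.1 b.1).symm
        show G.toSubmodule.subtype (G.toDGModule.proj i m) ∈ F.toSubmodule
        rw [key]
        exact F.proj_mem i _ hm
      d_mem := fun m hm => F.d_mem m.1 hm }

/-- The dg submodule generated by a set of homogeneous elements whose differentials lie in the
submodule that it spans. -/
def DGSub.span (M : DGModule 𝒜) (S : Set M.carrier) (hS : ∀ s ∈ S, ∃ i, s ∈ M.gr i)
    (hd : ∀ s ∈ S, M.d s ∈ Submodule.span Aᵐᵒᵖ S) : DGSub M where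
  toSubmodule := Submodule.span Aᵐᵒᵖ S
  proj_mem i m hm := by
    induction hm using Submodule.closure_induction with
    | zero => rw [map_zero]; exact zero_mem _
    | add x y _ _ hx hy => rw [map_add]; exact add_mem hx hy
    | smul_mem r s hs =>
      obtain ⟨j, hj⟩ := hS s hs
      refine 𝒜.induction (P := fun a => M.proj i (MulOpposite.op a • s) ∈
        Submodule.span Aᵐᵒᵖ S) ?_ ?_ ?_ r.unop
      · simp
      · intro l a ha
        have h1 := M.smul_mem j l s a hj ha
        by_cases hi : j + l = i
        · subst hi
          rw [M.proj_same h1]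
          exact Submodule.smul_mem _ _ (Submodule.subset_span hs)
        · rw [M.proj_ne hi h1]; exact zero_mem _
      · intro a b ha hb
        rw [MulOpposite.op_add, add_smul, map_add]
        exact add_mem ha hb
  d_mem m hm := by
    induction hm using Submodule.closure_induction with
    | zero => rw [map_zero]; exact zero_mem _
    | add x y _ _ hx hy => rw [map_add]; exact add_mem hx hy
    | smul_mem r s hs =>
      obtain ⟨j, hj⟩ := hS s hs
      have h := M.leibniz j s r.unop hj
      rw [MulOpposite.op_unop] at h
      rw [h]
      have h1 : MulOpposite.op (𝒜.d r.unop) • s ∈ Submodule.span Aᵐᵒᵖ S :=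
        Submodule.smul_mem _ _ (Submodule.subset_span hs)
      refine add_mem (Submodule.smul_mem _ _ (hd s hs)) ?_
      rcases Int.units_eq_one_or j.negOnePow with h2 | h2
      · rw [h2, one_smul]; exact h1
      · rw [h2, Units.neg_smul, one_smul]; exact neg_mem h1

/-! ### The reduction `M / M A^+`, its cohomology and lengths -/

/-- The graded submodule `M_{≤ i} = ∑_{j ≤ i} M^j A` generated by the parts of degree `≤ i`. -/
def le (M : DGModule 𝒜) (i : ℤ) : Submodule Aᵐᵒᵖ M.carrier :=
  Submodule.span Aᵐᵒᵖ {m | ∃ j ≤ i, m ∈ M.gr j}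

/-- The dg submodule `M A^+`, where `A^+ = ⨁_{j > 0} A^j`. It is generated by the products `m a`
with `m` homogeneous and `a` homogeneous of positive degree. -/
def mulAPlus (M : DGModule 𝒜) : DGSub M :=
  DGSub.span M {x | ∃ (i j : ℤ) (m : M.carrier) (a : A),
      m ∈ M.gr i ∧ 0 < j ∧ a ∈ 𝒜.gr j ∧ x = MulOpposite.op a • m}
    (by
      rintro _ ⟨i, j, m, a, hm, _, ha, rfl⟩
      exact ⟨_, M.smul_mem i j m a hm ha⟩)
    (by
      rintro _ ⟨i, j, m, a, hm, hj, ha, rfl⟩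
      rw [M.leibniz i m a hm]
      refine add_mem (Submodule.subset_span ⟨i + 1, j, _, a, M.d_mem i m hm, hj, ha, rfl⟩) ?_
      have h1 : MulOpposite.op (𝒜.d a) • m ∈ Submodule.span Aᵐᵒᵖ {x | ∃ (i j : ℤ)
          (m : M.carrier) (a : A), m ∈ M.gr i ∧ 0 < j ∧ a ∈ 𝒜.gr j ∧
            x = MulOpposite.op a • m} :=
        Submodule.subset_span ⟨i, j + 1, m, _, hm, by omega, 𝒜.d_mem j a ha, rfl⟩
      rcases Int.units_eq_one_or i.negOnePow with h2 | h2
      · rw [h2, one_smul]; exact h1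
      · rw [h2, Units.neg_smul, one_smul]; exact neg_mem h1)

/-- The dg module `M̄ = M / M A^+ = M ⊗_A A^0` (with `A^0 = A / A^+`). -/
def bar (M : DGModule 𝒜) : DGModule 𝒜 := M.quot M.mulAPlus

/-- The differential of `M̄` as a map of right `A^0`-modules. -/
def barD (M : DGModule 𝒜) : M.bar.carrier →ₗ[𝒜.A0ᵐᵒᵖ] M.bar.carrier where
  toFun := M.bar.d
  map_add' := map_add _
  map_smul' r x := by
    refine M.bar.induction (P := fun x => M.bar.d (r • x) = r • M.bar.d x) ?_ ?_ ?_ x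
    · simp
    · rintro i _ ⟨m, hm, rfl⟩
      have h := M.bar.leibniz i (M.mulAPlus.toSubmodule.mkQ m) (𝒜.A0incl r.unop) ⟨m, hm, rfl⟩
      have h0 : MulOpposite.op (𝒜.d (𝒜.A0incl r.unop)) •
          (show M.bar.carrier from M.mulAPlus.toSubmodule.mkQ m) = 0 := by
        refine (Submodule.Quotient.mk_eq_zero M.mulAPlus.toSubmodule).2 (Submodule.subset_span ?_)
        exact ⟨i, 0 + 1, m, _, hm, by omega, 𝒜.d_mem 0 _ (𝒜.A0incl_mem _), rfl⟩
      rw [h0, smul_zero, add_zero] at h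
      exact h
    · intro a b ha hb
      rw [smul_add, map_add, ha, hb, map_add, smul_add]

/-- The cohomology `H(M̄) = ker d / im d`, a right `A^0`-module. -/
abbrev barH (M : DGModule 𝒜) : Type u :=
  LinearMap.ker M.barD ⧸ (LinearMap.range M.barD).submoduleOf (LinearMap.ker M.barD)

/-- The length `λ(M̄)` of the right `A^0`-module `M̄`, in `ℕ ∪ {∞}`. -/
def barLength (M : DGModule 𝒜) : ℕ∞ := Module.length 𝒜.A0ᵐᵒᵖ M.bar.carrier

/-- The length `λ(H(M̄))` of the right `A^0`-module `H(M̄)`, in `ℕ ∪ {∞}`. -/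
def barHLength (M : DGModule 𝒜) : ℕ∞ := Module.length 𝒜.A0ᵐᵒᵖ M.barH

/-! ### The modules `L ⊗_{A^0} A` and the category `dgFilt` -/

/-- The dg module `L ⊗_ℤ A` for an abelian group `L` in degree zero, written as `A ⊗_ℤ L` with `A`
acting from the right on the factor `A`; the differential is `a ⊗ l ↦ d a ⊗ l`. -/
def tensorInt (𝒜 : DGAlgebra k A) (L : Type u) [AddCommGroup L] : DGModule 𝒜 where
  carrier := A ⊗[ℤ] L
  gr i := AddSubgroup.closure {x | ∃ a ∈ 𝒜.gr i, ∃ l : L, x = a ⊗ₜ[ℤ] l}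
  internal := isInternal_of_proj _
    (fun i => (LinearMap.rTensor L (𝒜.proj i).toIntLinearMap).toAddMonoidHom)
    (fun i x hx => by
      induction hx using AddSubgroup.closure_induction with
      | mem x hx =>
        obtain ⟨a, ha, l, rfl⟩ := hx
        simp [𝒜.proj_same ha]
      | zero => simp
      | add x y _ _ hx hy => rw [map_add, hx, hy]
      | neg x _ hx => rw [map_neg, hx])
    (fun i j hij x hx => by
      induction hx using AddSubgroup.closure_induction with
      | mem x hx =>
        obtain ⟨a, ha, l, rfl⟩ := hx
        simp [𝒜.proj_ne hij ha]
      | zero => simp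
      | add x y _ _ hx hy => rw [map_add, hx, hy, add_zero]
      | neg x _ hx => rw [map_neg, hx, neg_zero])
    (fun x => by
      induction x using TensorProduct.induction_on with
      | zero => exact zero_mem _
      | add x y hx hy => exact add_mem hx hy
      | tmul a l =>
        refine 𝒜.induction (P := fun a => a ⊗ₜ[ℤ] l ∈ ⨆ i, AddSubgroup.closure
          {x | ∃ a ∈ 𝒜.gr i, ∃ l : L, x = a ⊗ₜ[ℤ] l}) ?_ ?_ ?_ a
        · rw [TensorProduct.zero_tmul]; exact zero_mem _
        · exact fun i a ha => AddSubgroup.mem_iSup_of_mem (S := fun i => AddSubgroup.closure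
            {x | ∃ a ∈ 𝒜.gr i, ∃ l : L, x = a ⊗ₜ[ℤ] l}) i
            (AddSubgroup.subset_closure ⟨a, ha, l, rfl⟩)
        · intro a b ha hb
          rw [TensorProduct.add_tmul]
          exact add_mem ha hb)
  smul_mem i j x b hx hb := by
    induction hx using AddSubgroup.closure_induction with
    | mem x hx =>
      obtain ⟨a, ha, l, rfl⟩ := hx
      exact AddSubgroup.subset_closure ⟨a * b, SetLike.mul_mem_graded ha hb, l, rfl⟩
    | zero => rw [smul_zero]; exact zero_mem _
    | add x y _ _ hx hy => rw [smul_add]; exact add_mem hx hy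
    | neg x _ hx => rw [smul_neg]; exact neg_mem hx
  d := (LinearMap.rTensor L (𝒜.d.toAddMonoidHom.toIntLinearMap)).toAddMonoidHom
  d_mem i x hx := by
    induction hx using AddSubgroup.closure_induction with
    | mem x hx =>
      obtain ⟨a, ha, l, rfl⟩ := hx
      exact AddSubgroup.subset_closure ⟨𝒜.d a, 𝒜.d_mem i a ha, l, rfl⟩
    | zero => rw [map_zero]; exact zero_mem _
    | add x y _ _ hx hy => rw [map_add]; exact add_mem hx hy
    | neg x _ hx => rw [map_neg]; exact neg_mem hx
  d_d x := by
    induction x using TensorProduct.induction_on with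
    | zero => simp
    | add x y hx hy => rw [map_add, map_add, hx, hy, add_zero]
    | tmul a l => simp [𝒜.d_d]
  leibniz i x b hx := by
    induction hx using AddSubgroup.closure_induction with
    | mem x hx =>
      obtain ⟨a, ha, l, rfl⟩ := hx
      have h := congrArg (fun c => c ⊗ₜ[ℤ] l) (𝒜.leibniz i a b ha)
      rcases Int.units_eq_one_or i.negOnePow with h2 | h2
      · simp only [h2, one_smul, TensorProduct.add_tmul] at h ⊢
        exact h
      · simp only [h2, Units.neg_smul, one_smul, TensorProduct.add_tmul,
          TensorProduct.neg_tmul] at h ⊢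
        exact h
    | zero => simp
    | add x y _ _ hx hy =>
      simp only [smul_add, map_add, hx, hy]
      abel
    | neg x _ hx =>
      simp only [smul_neg, map_neg, hx]
      abel

/-- If `d(A^0) = 0`: the dg module `L̂ = L ⊗_{A^0} A` for a right `A^0`-module `L` in degree zero,
i.e. the quotient of `L ⊗_ℤ A` by the relations `l r ⊗ a = l ⊗ r a` for `r ∈ A^0`. -/
def hat {𝒜 : DGAlgebra k A} (h0 : ∀ a ∈ 𝒜.gr 0, 𝒜.d a = 0) (L : Type u) [AddCommGroup L]
    [Module 𝒜.A0ᵐᵒᵖ L] : DGModule 𝒜 :=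
  (tensorInt 𝒜 L).quot (DGSub.span (tensorInt 𝒜 L)
    {x | ∃ (j : ℤ) (a : A) (r : 𝒜.A0) (l : L), a ∈ 𝒜.gr j ∧
      x = (𝒜.A0incl r * a) ⊗ₜ[ℤ] l - a ⊗ₜ[ℤ] (MulOpposite.op r • l)}
    (by
      rintro _ ⟨j, a, r, l, ha, rfl⟩
      refine ⟨j, sub_mem (AddSubgroup.subset_closure ⟨_, ?_, l, rfl⟩)
        (AddSubgroup.subset_closure ⟨a, ha, _, rfl⟩)⟩
      simpa using SetLike.mul_mem_graded (𝒜.A0incl_mem r) ha)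
    (by
      rintro _ ⟨j, a, r, l, ha, rfl⟩
      refine Submodule.subset_span ⟨j + 1, 𝒜.d a, r, l, 𝒜.d_mem j a ha, ?_⟩
      have h : 𝒜.d (𝒜.A0incl r * a) = 𝒜.A0incl r * 𝒜.d a := by
        rw [𝒜.leibniz 0 _ a (𝒜.A0incl_mem r), h0 _ (𝒜.A0incl_mem r)]; simp
      rw [← h]
      exact map_sub (tensorInt 𝒜 L).d _ _))

/-- `M` is in `dgFilt(𝒜)`: there is a finite filtration `0 = F_0 ⊆ F_1 ⊆ ... ⊆ F_n = M` by dg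
submodules with subquotients `F_i / F_{i-1} ≅ {l_i} L̂_i` in `dgMod(𝒜)` for simple right
`A^0`-modules `L_i` and integers `l_1 ≥ l_2 ≥ ... ≥ l_n`. -/
def IsFilt (h0 : ∀ a ∈ 𝒜.gr 0, 𝒜.d a = 0) (M : DGModule 𝒜) : Prop :=
  ∃ (n : ℕ) (F : Fin (n + 1) → DGSub M) (l : Fin n → ℤ),
    (F 0).toSubmodule = ⊥ ∧ (F (Fin.last n)).toSubmodule = ⊤ ∧ Antitone l ∧
    ∀ i : Fin n, (F i.castSucc).toSubmodule ≤ (F i.succ).toSubmodule ∧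
      ∃ (L : Type u) (_ : AddCommGroup L) (_ : Module 𝒜.A0ᵐᵒᵖ L),
        IsSimpleModule 𝒜.A0ᵐᵒᵖ L ∧
        Iso (subquot (F i.castSucc) (F i.succ)) (shift (l i) (hat h0 L))

end DGModule

end

/-!
Everything is controlled by reduction modulo `A^+`. A minimal dg module `N` is one with
`d N ⊆ N A^+`, i.e. one whose reduction `N̄` has differential zero. If `N` is moreover bounded
below, an endomorphism `f` of `N` homotopic to the identity induces the identity on `N̄`, so `f` is
an isomorphism by Nakayama's lemma.

Every perfect dg module is homotopy equivalent to a minimal one whose underlying graded module is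
finitely generated and projective. Such a minimal module is filtered: since `A^0` is semisimple and
`d A^0 = 0`, its lowest nonzero degree contains a simple module `L` of cycles, hence a copy of a
shift of `L̂`, and dividing by it lowers the length of `N̄`.

Finally `λ(H(M̄)) ≤ λ(M̄)`, the left side is a homotopy invariant, and, when it is finite, equality
holds if and only if the differential of `M̄` vanishes.
-/

section LinearAlgebra

variable {R X Y : Type*} [Ring R] [AddCommGroup X] [Module R X] [AddCommGroup Y] [Module R Y]

theorem exists_comp_comp_eq_self [IsSemisimpleModule R X] [IsSemisimpleModule R Y]
    (φ : X →ₗ[R] Y) : ∃ ψ : Y →ₗ[R] X, φ ∘ₗ ψ ∘ₗ φ = φ := by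
  obtain ⟨s, hs⟩ := IsSemisimpleModule.lifting_property φ.rangeRestrict
    φ.surjective_rangeRestrict LinearMap.id
  obtain ⟨ψ, hψ⟩ := IsSemisimpleModule.extension_property (LinearMap.range φ).subtype
    Subtype.val_injective s
  refine ⟨ψ, LinearMap.ext fun x => ?_⟩
  have hψs : ψ (φ x) = s (φ.rangeRestrict x) := LinearMap.congr_fun hψ (φ.rangeRestrict x)
  have hφs : φ (s (φ.rangeRestrict x)) = φ x :=
    congrArg Subtype.val (LinearMap.congr_fun hs (φ.rangeRestrict x))
  exact (congrArg φ hψs).trans hφs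

theorem intUnits_smul_mem {S : Type*} [SetLike S X] [AddSubgroupClass S X]
    {s : S} (ε : ℤˣ) {x : X} (hx : x ∈ s) : ε • x ∈ s :=
  zsmul_mem hx ε.val

theorem isNilpotent_of_forall_exists_pow_apply_eq_zero [Module.Finite R X] {ν : Module.End R X}
    (h : ∀ x, ∃ n : ℕ, (ν ^ n) x = 0) : IsNilpotent ν := by
  obtain ⟨S, hS⟩ := Module.Finite.fg_top (R := R) (M := X)
  choose g hg using h
  refine ⟨S.sup g, LinearMap.ext_on hS fun x hx => ?_⟩
  exact Module.End.pow_map_zero_of_le (Finset.le_sup hx) (hg x)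

theorem bijective_of_forall_exists_one_sub_pow_apply_eq_zero (φ : Module.End R X)
    (h : ∀ x, ∃ n : ℕ, ((1 - φ) ^ n) x = 0) : Function.Bijective φ := by
  constructor
  · refine (injective_iff_map_eq_zero φ).2 fun x hx => ?_
    obtain ⟨n, hn⟩ := h x
    have hfix : ((1 - φ) ^ n) x = x := by
      rw [Module.End.pow_apply]
      exact Function.iterate_fixed (by simp [hx]) n
    rwa [hfix] at hn
  · intro y
    obtain ⟨n, hn⟩ := h y
    refine ⟨(∑ i ∈ Finset.range n, (1 - φ) ^ i) y, ?_⟩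
    simpa [hn] using LinearMap.congr_fun (mul_neg_geom_sum (1 - φ) n) y

end LinearAlgebra

section Contraction

variable {R : Type*} [Ring R] {d s : R}

theorem mul_one_sub_contraction (hd : d * d = 0) (hs : d * s * d = d) :
    d * (1 - (d * s + s * d)) = 0 := by
  linear_combination (norm := noncomm_ring) (-1 : R) * hs - hd * s

theorem isIdempotentElem_one_sub_contraction_sq (hd : d * d = 0) (hs : d * s * d = d) :
    IsIdempotentElem ((1 - (d * s + s * d)) * (1 - (d * s + s * d))) := by
  have hright : (1 - (d * s + s * d)) * d = 0 := by
    linear_combination (norm := noncomm_ring) (-1 : R) * hs - s * hd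
  set τ := 1 - (d * s + s * d) with hτ
  have hsq : τ * τ = τ + d * s * s * d := by
    have hτs : τ * (s * d) = -(d * s * s * d) := by
      rw [hτ]
      linear_combination (norm := noncomm_ring) (-s) * hs
    calc τ * τ = τ - τ * d * s - τ * (s * d) := by rw [hτ]; noncomm_ring
      _ = τ + d * s * s * d := by rw [hright, hτs, zero_mul, sub_zero, sub_neg_eq_add]
  have hcube : τ * (τ * τ) = τ * τ := by
    rw [hsq, mul_add]
    linear_combination (norm := noncomm_ring) hsq + hright * (s * s * d)
  rw [IsIdempotentElem, mul_assoc, hcube, hcube]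

end Contraction

variable {k : Type w} {A : Type u} [CommRing k] [Ring A] [Algebra k A] {𝒜 : DGAlgebra k A}

/-- A dg algebra concentrated in degrees `≥ 0`. -/
class DGAlgebra.IsNonneg (𝒜 : DGAlgebra k A) : Prop where
  gr_eq_bot : ∀ i < 0, 𝒜.gr i = ⊥

theorem DGAlgebra.nonneg_induction (𝒜 : DGAlgebra k A) [𝒜.IsNonneg] {P : A → Prop} (zero : P 0)
    (hom : ∀ i ≥ 0, ∀ a ∈ 𝒜.gr i, P a) (add : ∀ a b, P a → P b → P (a + b)) (a : A) : P a := by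
  refine 𝒜.induction zero (fun i a ha => ?_) add a
  rcases lt_or_ge i 0 with hi | hi
  · rw [IsNonneg.gr_eq_bot i hi, Submodule.mem_bot] at ha
    exact ha ▸ zero
  · exact hom i hi a ha

namespace DGModule

variable {M N P : DGModule 𝒜}

/-! ### Homogeneous components -/

theorem eq_zero_of_forall_proj_eq_zero {x : M.carrier} (h : ∀ i, M.proj i x = 0) : x = 0 := by
  obtain ⟨s, hs⟩ := M.exists_sum_proj x
  rw [← hs, Finset.sum_eq_zero fun i _ => h i]

theorem mem_gr_iff_proj_eq {i : ℤ} {x : M.carrier} : x ∈ M.gr i ↔ M.proj i x = x :=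
  ⟨M.proj_same, fun h => h ▸ M.proj_mem i x⟩

theorem proj_eq_zero_of_lt {a : ℤ} (ha : ∀ i < a, M.gr i = ⊥) {i : ℤ} (hi : i < a)
    (x : M.carrier) : M.proj i x = 0 := by
  have := M.proj_mem i x
  rwa [ha i hi, AddSubgroup.mem_bot] at this

theorem map_proj (f : M.carrier →+ N.carrier) (n : ℤ)
    (hf : ∀ i, ∀ m ∈ M.gr i, f m ∈ N.gr (i + n)) (i : ℤ) (x : M.carrier) :
    f (M.proj i x) = N.proj (i + n) (f x) := by
  refine M.induction (P := fun x => f (M.proj i x) = N.proj (i + n) (f x)) (by simp)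
    (fun j m hm => ?_) (fun a b ha hb => by simp only [map_add, ha, hb]) x
  by_cases hij : j = i
  · subst hij
    rw [M.proj_same hm, N.proj_same (hf _ _ hm)]
  · rw [M.proj_ne hij hm, N.proj_ne (by omega) (hf _ _ hm), map_zero]

theorem d_proj (M : DGModule 𝒜) (i : ℤ) (x : M.carrier) :
    M.d (M.proj i x) = M.proj (i + 1) (M.d x) :=
  map_proj M.d 1 M.d_mem i x

theorem proj_smul (M : DGModule 𝒜) {j : ℤ} {a : A} (ha : a ∈ 𝒜.gr j) (i : ℤ) (x : M.carrier) :
    M.proj i (MulOpposite.op a • x) = MulOpposite.op a • M.proj (i - j) x := by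
  have := map_proj (DistribSMul.toAddMonoidHom M.carrier (MulOpposite.op a)) j
    (fun i m hm => M.smul_mem i j m a hm ha) (i - j) x
  rw [sub_add_cancel] at this
  exact this.symm

/-- The `A`-linear map `f` is homogeneous of degree `n`; it need not respect the differentials. -/
def HasDegree (f : M.carrier →ₗ[Aᵐᵒᵖ] N.carrier) (n : ℤ) : Prop :=
  ∀ i, ∀ m ∈ M.gr i, f m ∈ N.gr (i + n)

theorem Hom.hasDegree (f : Hom M N) : HasDegree f.toLin 0 := by
  simpa [HasDegree] using f.map_mem

theorem HasDegree.comp {f : M.carrier →ₗ[Aᵐᵒᵖ] N.carrier} {g : N.carrier →ₗ[Aᵐᵒᵖ] P.carrier}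
    {m n : ℤ} (hg : HasDegree g n) (hf : HasDegree f m) : HasDegree (g ∘ₗ f) (m + n) :=
  fun i x hx => add_assoc i m n ▸ hg _ _ (hf i x hx)

theorem HasDegree.map_proj {f : M.carrier →ₗ[Aᵐᵒᵖ] N.carrier} {n : ℤ} (hf : HasDegree f n)
    (i : ℤ) (x : M.carrier) : f (M.proj i x) = N.proj (i + n) (f x) :=
  DGModule.map_proj f.toAddMonoidHom n hf i x

theorem Hom.map_proj (f : Hom M N) (i : ℤ) (x : M.carrier) :
    f.toLin (M.proj i x) = N.proj i (f.toLin x) := by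
  rw [f.hasDegree.map_proj, add_zero]

theorem exists_component (f : M.carrier →ₗ[Aᵐᵒᵖ] N.carrier) (n : ℤ) :
    ∃ g : M.carrier →ₗ[Aᵐᵒᵖ] N.carrier, HasDegree g n ∧
      ∀ i, ∀ m ∈ M.gr i, g m = N.proj (i + n) (f m) := by
  classical
  let _ := M.internal.chooseDecomposition
  let g : M.carrier →+ N.carrier :=
    (DirectSum.toAddMonoid fun i =>
      ((N.proj (i + n)).comp f.toAddMonoidHom).comp (M.gr i).subtype).comp
      (DirectSum.decomposeAddEquiv M.gr).toAddMonoidHom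
  have hg : ∀ i, ∀ m ∈ M.gr i, g m = N.proj (i + n) (f m) := fun i m hm => by
    change DirectSum.toAddMonoid (fun i =>
      ((N.proj (i + n)).comp f.toAddMonoidHom).comp (M.gr i).subtype)
      (DirectSum.decompose M.gr m) = _
    rw [DirectSum.decompose_of_mem M.gr hm, DirectSum.toAddMonoid_of]
    rfl
  have hsmul : ∀ (a : A) (x : M.carrier), g (MulOpposite.op a • x) = MulOpposite.op a • g x := by
    intro a x
    refine M.induction (P := fun x => g (MulOpposite.op a • x) = MulOpposite.op a • g x) (by simp)
      (fun i m hm => ?_) (fun x y hx hy => by simp only [smul_add, map_add, hx, hy]) x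
    refine 𝒜.induction (P := fun a => g (MulOpposite.op a • m) = MulOpposite.op a • g m)
      (by simp) (fun j a ha => ?_)
      (fun a b ha hb => by simp only [MulOpposite.op_add, add_smul, map_add, ha, hb]) a
    rw [hg _ _ (M.smul_mem i j m a hm ha), hg _ _ hm, map_smul, N.proj_smul ha,
      show i + j + n - j = i + n by ring]
  refine ⟨{ g with map_smul' := fun r x => hsmul r.unop x }, fun i m hm => ?_, hg⟩
  exact (hg i m hm).symm ▸ N.proj_mem _ _

/-! ### The submodules `S A^{≥ n}` -/

/-- The `A`-submodule `S A^{≥ n}` spanned by the products of elements of `S ⊆ M` with homogeneous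
elements of `A` of degree at least `n`. -/
def smulGE (M : DGModule 𝒜) (S : Set M.carrier) (n : ℤ) : Submodule Aᵐᵒᵖ M.carrier :=
  Submodule.span Aᵐᵒᵖ {x | ∃ j ≥ n, ∃ a ∈ 𝒜.gr j, ∃ y ∈ S, x = MulOpposite.op a • y}

theorem smul_mem_smulGE {S : Set M.carrier} {n j : ℤ} (hj : n ≤ j) {a : A} (ha : a ∈ 𝒜.gr j)
    {y : M.carrier} (hy : y ∈ S) : MulOpposite.op a • y ∈ M.smulGE S n :=
  Submodule.subset_span ⟨j, hj, a, ha, y, hy, rfl⟩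

theorem mem_smulGE_zero {S : Set M.carrier} {x : M.carrier} (hx : x ∈ S) : x ∈ M.smulGE S 0 := by
  simpa using smul_mem_smulGE (le_refl 0) (SetLike.GradedOne.one_mem (A := 𝒜.gr)) hx

theorem smulGE_mono {S T : Set M.carrier} (h : S ⊆ T) {m n : ℤ} (hmn : m ≤ n) :
    M.smulGE S n ≤ M.smulGE T m :=
  Submodule.span_mono fun _ ⟨j, hj, a, ha, y, hy, e⟩ => ⟨j, hmn.trans hj, a, ha, y, h hy, e⟩

theorem map_smulGE_le (f : M.carrier →ₗ[Aᵐᵒᵖ] N.carrier) {S : Set M.carrier}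
    {T : Set N.carrier} (h : Set.MapsTo f S T) (n : ℤ) :
    (M.smulGE S n).map f ≤ N.smulGE T n := by
  rw [smulGE, Submodule.map_span, Submodule.span_le]
  rintro _ ⟨_, ⟨j, hj, a, ha, y, hy, rfl⟩, rfl⟩
  rw [map_smul]
  exact smul_mem_smulGE hj ha (h hy)

theorem map_mem_smulGE_univ (f : M.carrier →ₗ[Aᵐᵒᵖ] N.carrier) {n : ℤ} {x : M.carrier}
    (hx : x ∈ M.smulGE Set.univ n) : f x ∈ N.smulGE Set.univ n :=
  map_smulGE_le f (Set.mapsTo_univ _ _) n ⟨x, hx, rfl⟩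

theorem mem_mulAPlus {x : M.carrier} :
    x ∈ M.mulAPlus.toSubmodule ↔ x ∈ M.smulGE Set.univ 1 := by
  suffices M.mulAPlus.toSubmodule = M.smulGE Set.univ 1 by rw [this]
  refine le_antisymm (Submodule.span_mono ?_) (Submodule.span_le.2 ?_)
  · rintro _ ⟨i, j, m, a, _, hj, ha, rfl⟩
    exact ⟨j, by omega, a, ha, m, trivial, rfl⟩
  · rintro _ ⟨j, hj, a, ha, y, _, rfl⟩
    refine M.induction (P := fun y => MulOpposite.op a • y ∈ M.mulAPlus.toSubmodule) (by simp)
      (fun i y hy => Submodule.subset_span ⟨i, j, y, a, hy, by omega, ha, rfl⟩)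
      (fun x y hx hy => ?_) y
    rw [smul_add]
    exact add_mem hx hy

/-- The condition `d(M) ⊆ M A^+`. -/
def IsMinimal (M : DGModule 𝒜) : Prop := ∀ x, M.d x ∈ M.smulGE Set.univ 1

section Nonneg

variable [𝒜.IsNonneg]

theorem smulGE_induction {S : Set M.carrier} {n : ℤ} {P : M.carrier → Prop} (zero : P 0)
    (add : ∀ x y, P x → P y → P (x + y))
    (smul : ∀ j ≥ n, ∀ a ∈ 𝒜.gr j, ∀ y ∈ S, P (MulOpposite.op a • y)) {x : M.carrier}
    (hx : x ∈ M.smulGE S n) : P x := by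
  induction hx using Submodule.closure_induction with
  | zero => exact zero
  | add x y _ _ hx hy => exact add x y hx hy
  | smul_mem r s hs =>
    obtain ⟨j, hj, a, ha, y, hy, rfl⟩ := hs
    refine 𝒜.nonneg_induction (P := fun c => P (MulOpposite.op c • MulOpposite.op a • y))
      (by simpa using zero) (fun i hi c hc => ?_) (fun b c hb hc => ?_) r.unop
    · rw [smul_smul, ← MulOpposite.op_mul]
      exact smul (j + i) (by omega) _ (SetLike.mul_mem_graded ha hc) y hy
    · rw [MulOpposite.op_add, add_smul]
      exact add _ _ hb hc

theorem smulGE_univ_induction {n : ℤ} {P : M.carrier → Prop} (zero : P 0)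
    (add : ∀ x y, P x → P y → P (x + y))
    (smul : ∀ j ≥ n, ∀ a ∈ 𝒜.gr j, ∀ i, ∀ y ∈ M.gr i, P (MulOpposite.op a • y)) {x : M.carrier}
    (hx : x ∈ M.smulGE Set.univ n) : P x := by
  refine smulGE_induction zero add (fun j hj a ha y _ => ?_) hx
  refine M.induction (P := fun y => P (MulOpposite.op a • y)) (by simpa using zero)
    (fun i y hy => smul j hj a ha i y hy) (fun x y hx hy => ?_) y
  rw [smul_add]
  exact add _ _ hx hy

theorem smulGE_smulGE_le (S : Set M.carrier) (m n : ℤ) :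
    M.smulGE (M.smulGE S m) n ≤ M.smulGE S (m + n) := by
  refine Submodule.span_le.2 ?_
  rintro _ ⟨j, hj, b, hb, y, hy, rfl⟩
  refine smulGE_induction (P := fun y => MulOpposite.op b • y ∈ M.smulGE S (m + n)) (by simp)
    (fun x y hx hy => ?_) (fun i hi a ha y hy => ?_) hy
  · rw [smul_add]
    exact add_mem hx hy
  · rw [smul_smul, ← MulOpposite.op_mul]
    exact smul_mem_smulGE (by omega) (SetLike.mul_mem_graded ha hb) hy

theorem proj_eq_zero_of_mem_smulGE {a : ℤ} (hM : ∀ i < a, M.gr i = ⊥) {n i : ℤ} (hi : i < a + n)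
    {x : M.carrier} (hx : x ∈ M.smulGE Set.univ n) : M.proj i x = 0 := by
  refine smulGE_induction (P := fun x => M.proj i x = 0) (by simp)
    (fun x y hx hy => by rw [map_add, hx, hy, add_zero]) (fun j hj c hc y _ => ?_) hx
  rw [M.proj_smul hc, proj_eq_zero_of_lt hM (by omega), smul_zero]

theorem op_d_smul_mem_smulGE (a : A) {S : Set M.carrier} {x : M.carrier} (hx : x ∈ S) :
    MulOpposite.op (𝒜.d a) • x ∈ M.smulGE S 1 := by
  refine 𝒜.nonneg_induction (P := fun a => MulOpposite.op (𝒜.d a) • x ∈ M.smulGE S 1) (by simp)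
    (fun i hi a ha => smul_mem_smulGE (by omega) (𝒜.d_mem i a ha) hx) (fun a b ha hb => ?_) a
  rw [map_add, MulOpposite.op_add, add_smul]
  exact add_mem ha hb

theorem IsMinimal.d_mem_smulGE_two (hM : M.IsMinimal) {x : M.carrier}
    (hx : x ∈ M.smulGE Set.univ 1) : M.d x ∈ M.smulGE Set.univ 2 := by
  refine smulGE_univ_induction (P := fun x => M.d x ∈ M.smulGE Set.univ 2) (by simp)
    (fun x y hx hy => ?_) (fun j hj a ha i y hy => ?_) hx
  · rw [map_add]
    exact add_mem hx hy
  · rw [M.leibniz i y a hy]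
    refine add_mem ?_ (intUnits_smul_mem _ ?_)
    · exact smulGE_smulGE_le Set.univ 1 1 (smul_mem_smulGE hj ha (hM y))
    · exact smul_mem_smulGE (by omega) (𝒜.d_mem j a ha) trivial

theorem isBoundedBelow_of_finite [Module.Finite Aᵐᵒᵖ M.carrier] : M.IsBoundedBelow := by
  have hbdd : ∀ x : M.carrier, ∃ a : ℤ, ∀ i < a, M.proj i x = 0 := by
    refine M.induction ⟨0, by simp⟩ (fun i m hm => ⟨i, fun j hj => M.proj_ne (by omega) hm⟩) ?_
    rintro x y ⟨a, ha⟩ ⟨b, hb⟩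
    refine ⟨min a b, fun i hi => ?_⟩
    rw [map_add, ha i (by omega), hb i (by omega), add_zero]
  choose g hg using hbdd
  obtain ⟨S, hS⟩ := Module.Finite.fg_top (R := Aᵐᵒᵖ) (M := M.carrier)
  obtain ⟨a, ha⟩ := (S.image g).bddBelow
  have hle : ∀ s ∈ S, a ≤ g s := fun s hs => ha (Finset.mem_coe.2 (Finset.mem_image_of_mem g hs))
  have hzero : ∀ x : M.carrier, ∀ i < a, M.proj i x = 0 := fun x i hi => by
    have hx : x ∈ M.smulGE S 0 := by
      exact Submodule.span_le.2 (fun s hs => mem_smulGE_zero hs) (hS ▸ Submodule.mem_top (x := x))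
    refine smulGE_induction (P := fun x => M.proj i x = 0) (by simp)
      (fun x y hx hy => by rw [map_add, hx, hy, add_zero]) (fun j hj c hc s hs => ?_) hx
    rw [M.proj_smul hc, hg s _ (by have := hle s hs; omega), smul_zero]
  refine ⟨a, fun i hi => eq_bot_iff.2 fun x hx => ?_⟩
  rw [AddSubgroup.mem_bot, ← M.proj_same hx, hzero x i hi]

theorem HasDegree.exists_pow_apply_eq_zero (hM : M.IsBoundedBelow)
    {ν : Module.End Aᵐᵒᵖ M.carrier} (hdeg : HasDegree ν 0)
    (hν : ∀ x, ν x ∈ M.smulGE Set.univ 1) (x : M.carrier) : ∃ n : ℕ, (ν ^ n) x = 0 := by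
  obtain ⟨a, ha⟩ := hM
  have hpow : ∀ (n : ℕ) (x), (ν ^ n) x ∈ M.smulGE Set.univ n := fun n => by
    induction n with
    | zero => exact fun x => mem_smulGE_zero trivial
    | succ n ih =>
      intro x
      rw [pow_succ, Module.End.mul_apply]
      have := map_smulGE_le (ν ^ n) (T := M.smulGE Set.univ n) (fun y _ => ih y) 1
        ⟨_, hν x, rfl⟩
      simpa using smulGE_smulGE_le Set.univ _ _ this
  have hpowdeg : ∀ n : ℕ, HasDegree (M := M) (N := M) (ν ^ n) 0 := fun n => by
    induction n with
    | zero => simp [HasDegree]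
    | succ n ih => simpa [pow_succ, Module.End.mul_eq_comp] using ih.comp hdeg
  refine M.induction (P := fun x => ∃ n : ℕ, (ν ^ n) x = 0) ⟨0, by simp⟩
    (fun i m hm => ⟨(i - a + 1).toNat, ?_⟩) ?_ x
  · rw [← M.proj_same hm, (hpowdeg _).map_proj]
    exact proj_eq_zero_of_mem_smulGE ha (by omega) (hpow _ m)
  · rintro x y ⟨m, hm⟩ ⟨n, hn⟩
    refine ⟨max m n, ?_⟩
    rw [map_add, Module.End.pow_map_zero_of_le (le_max_left m n) hm,
      Module.End.pow_map_zero_of_le (le_max_right m n) hn, add_zero]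

theorem HasDegree.bijective_of_sub_mem (hM : M.IsBoundedBelow)
    {φ : Module.End Aᵐᵒᵖ M.carrier} (hdeg : HasDegree φ 0)
    (hφ : ∀ x, φ x - x ∈ M.smulGE Set.univ 1) : Function.Bijective φ := by
  refine bijective_of_forall_exists_one_sub_pow_apply_eq_zero φ
    (HasDegree.exists_pow_apply_eq_zero hM (fun i m hm => ?_) fun x => ?_)
  · exact sub_mem (by simpa using hm) (hdeg i m hm)
  · simpa using neg_mem (hφ x)

end Nonneg

/-! ### Reduction modulo `M A^+` -/

instance : LinearMap.CompatibleSMul M.carrier N.carrier 𝒜.A0ᵐᵒᵖ Aᵐᵒᵖ :=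
  ⟨fun f r x => f.map_smul (MulOpposite.op (𝒜.A0incl r.unop)) x⟩

/-- The projection `M → M̄`. -/
def barMk (M : DGModule 𝒜) : M.carrier →ₗ[Aᵐᵒᵖ] M.bar.carrier :=
  M.mulAPlus.toSubmodule.mkQ

theorem barMk_surjective (M : DGModule 𝒜) : Function.Surjective M.barMk :=
  M.mulAPlus.toSubmodule.mkQ_surjective

theorem barMk_eq_zero {x : M.carrier} : M.barMk x = 0 ↔ x ∈ M.smulGE Set.univ 1 :=
  (Submodule.Quotient.mk_eq_zero M.mulAPlus.toSubmodule).trans mem_mulAPlus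

theorem barMk_proj (i : ℤ) (x : M.carrier) : M.barMk (M.proj i x) = M.bar.proj i (M.barMk x) := by
  have := map_proj M.barMk.toAddMonoidHom 0
    (fun i m hm => (add_zero i).symm ▸ (⟨m, hm, rfl⟩ : M.barMk m ∈ M.bar.gr i)) i x
  rwa [add_zero] at this

theorem barD_barMk (x : M.carrier) : M.barD (M.barMk x) = M.barMk (M.d x) := rfl

theorem barD_comp_barD (M : DGModule 𝒜) : M.barD ∘ₗ M.barD = 0 :=
  LinearMap.ext M.bar.d_d

theorem isMinimal_iff_barD_eq_zero : M.IsMinimal ↔ M.barD = 0 := by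
  refine ⟨fun h => LinearMap.ext fun z => ?_, fun h x => ?_⟩
  · obtain ⟨x, rfl⟩ := M.barMk_surjective z
    exact barMk_eq_zero.2 (h x)
  · exact barMk_eq_zero.1 (LinearMap.congr_fun h (M.barMk x))

/-- The map `M̄ → N̄` induced by an `A`-linear map `M → N`. -/
def barMap (f : M.carrier →ₗ[Aᵐᵒᵖ] N.carrier) : M.bar.carrier →ₗ[𝒜.A0ᵐᵒᵖ] N.bar.carrier :=
  let f' : M.bar.carrier →ₗ[Aᵐᵒᵖ] N.bar.carrier :=
    Submodule.mapQ M.mulAPlus.toSubmodule N.mulAPlus.toSubmodule f fun _ hx =>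
      mem_mulAPlus.2 (map_mem_smulGE_univ f (mem_mulAPlus.1 hx))
  f'.restrictScalars 𝒜.A0ᵐᵒᵖ

theorem barMap_barMk (f : M.carrier →ₗ[Aᵐᵒᵖ] N.carrier) (x : M.carrier) :
    barMap f (M.barMk x) = N.barMk (f x) := rfl

theorem bar_hom_ext {f g : M.bar.carrier →ₗ[𝒜.A0ᵐᵒᵖ] N.bar.carrier}
    (h : ∀ x, f (M.barMk x) = g (M.barMk x)) : f = g :=
  LinearMap.ext fun z => by
    obtain ⟨x, rfl⟩ := M.barMk_surjective z
    exact h x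

theorem barMap_id : barMap (LinearMap.id : M.carrier →ₗ[Aᵐᵒᵖ] M.carrier) = LinearMap.id :=
  bar_hom_ext fun _ => rfl

theorem barMap_comp (g : N.carrier →ₗ[Aᵐᵒᵖ] P.carrier) (f : M.carrier →ₗ[Aᵐᵒᵖ] N.carrier) :
    barMap (g ∘ₗ f) = barMap g ∘ₗ barMap f :=
  bar_hom_ext fun _ => rfl

theorem barMap_add (f g : M.carrier →ₗ[Aᵐᵒᵖ] N.carrier) : barMap (f + g) = barMap f + barMap g :=
  bar_hom_ext fun x => by simp only [barMap_barMk, LinearMap.add_apply, map_add]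

theorem Hom.barMap_comp_barD (f : Hom M N) :
    barMap f.toLin ∘ₗ M.barD = N.barD ∘ₗ barMap f.toLin :=
  bar_hom_ext fun x => congrArg N.barMk (f.map_d x)

theorem Homotopic.exists_barMap_sub_eq {f g : Hom M N} (h : Homotopic f g) :
    ∃ s : M.bar.carrier →ₗ[𝒜.A0ᵐᵒᵖ] N.bar.carrier,
      barMap f.toLin - barMap g.toLin = N.barD ∘ₗ s + s ∘ₗ M.barD := by
  obtain ⟨s, _, hs⟩ := h
  refine ⟨barMap s, bar_hom_ext fun x => ?_⟩
  have := congrArg N.barMk (hs x)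
  rwa [map_sub, map_add] at this

theorem Homotopic.barMap_eq {f g : Hom M N} (h : Homotopic f g) (hM : M.IsMinimal)
    (hN : N.IsMinimal) : barMap f.toLin = barMap g.toLin := by
  obtain ⟨s, hs⟩ := h.exists_barMap_sub_eq
  rw [isMinimal_iff_barD_eq_zero] at hM hN
  rwa [hM, hN, LinearMap.zero_comp, LinearMap.comp_zero, add_zero, sub_eq_zero] at hs

section Nonneg

variable [𝒜.IsNonneg]

theorem op_smul_bar (a : A) (z : M.bar.carrier) :
    MulOpposite.op a • z = MulOpposite.op (𝒜.proj 0 a) • z := by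
  obtain ⟨x, rfl⟩ := M.barMk_surjective z
  refine 𝒜.nonneg_induction (P := fun a => MulOpposite.op a • M.barMk x =
    MulOpposite.op (𝒜.proj 0 a) • M.barMk x) (by simp) (fun i hi a ha => ?_)
    (fun a b ha hb => by simp only [map_add, MulOpposite.op_add, add_smul, ha, hb]) a
  rcases hi.eq_or_lt with rfl | hi
  · rw [𝒜.proj_same ha]
  · rw [𝒜.proj_ne hi.ne' ha, MulOpposite.op_zero, zero_smul, ← map_smul, barMk_eq_zero]
    exact smul_mem_smulGE (by omega) ha trivial

theorem map_op_smul_bar (ψ : M.bar.carrier →ₗ[𝒜.A0ᵐᵒᵖ] N.bar.carrier) (a : A)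
    (z : M.bar.carrier) : ψ (MulOpposite.op a • z) = MulOpposite.op a • ψ z := by
  rw [op_smul_bar, op_smul_bar a (ψ z)]
  let r : 𝒜.A0 := ⟨𝒜.proj 0 a, (DirectSum.decompose 𝒜.gr a 0).2⟩
  exact ψ.map_smul (MulOpposite.op r) z

instance finite_bar [Module.Finite Aᵐᵒᵖ M.carrier] : Module.Finite 𝒜.A0ᵐᵒᵖ M.bar.carrier := by
  have : Module.Finite Aᵐᵒᵖ M.bar.carrier := .of_surjective M.barMk M.barMk_surjective
  obtain ⟨S, hS⟩ := Module.Finite.fg_top (R := Aᵐᵒᵖ) (M := M.bar.carrier)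
  refine ⟨S, eq_top_iff.2 fun z _ => ?_⟩
  have hz : z ∈ Submodule.span Aᵐᵒᵖ (S : Set M.bar.carrier) := hS ▸ Submodule.mem_top
  induction hz using Submodule.span_induction with
  | mem z hz => exact Submodule.subset_span hz
  | zero => exact zero_mem _
  | add y z _ _ hy hz => exact add_mem (hy trivial) (hz trivial)
  | smul r z _ hz =>
    rw [← MulOpposite.op_unop r, op_smul_bar]
    let r₀ : 𝒜.A0 := ⟨𝒜.proj 0 r.unop, (DirectSum.decompose 𝒜.gr r.unop 0).2⟩
    exact Submodule.smul_mem _ (MulOpposite.op r₀) (hz trivial)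

theorem exists_barMap_eq [Module.Projective Aᵐᵒᵖ M.carrier]
    (ψ : M.bar.carrier →ₗ[𝒜.A0ᵐᵒᵖ] N.bar.carrier) :
    ∃ f : M.carrier →ₗ[Aᵐᵒᵖ] N.carrier, barMap f = ψ := by
  let ψA : M.bar.carrier →ₗ[Aᵐᵒᵖ] N.bar.carrier :=
    { ψ with map_smul' := fun r z => map_op_smul_bar ψ r.unop z }
  obtain ⟨f, hf⟩ := Module.projective_lifting_property N.barMk (ψA ∘ₗ M.barMk) N.barMk_surjective
  exact ⟨f, bar_hom_ext fun x => LinearMap.congr_fun hf x⟩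

theorem exists_hasDegree_quasiInverse [IsSemisimpleRing 𝒜.A0] [Module.Projective Aᵐᵒᵖ N.carrier]
    (φ : M.bar.carrier →ₗ[𝒜.A0ᵐᵒᵖ] N.bar.carrier) {n : ℤ}
    (hφ : ∀ i, ∀ x ∈ M.bar.gr i, φ x ∈ N.bar.gr (i + n)) :
    ∃ f : N.carrier →ₗ[Aᵐᵒᵖ] M.carrier, HasDegree f (-n) ∧ φ ∘ₗ barMap f ∘ₗ φ = φ := by
  obtain ⟨ψ, hψ⟩ := exists_comp_comp_eq_self φ
  obtain ⟨g, rfl⟩ := exists_barMap_eq ψ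
  obtain ⟨f, hfdeg, hf⟩ := exists_component g (-n)
  refine ⟨f, hfdeg, LinearMap.ext fun z => ?_⟩
  refine M.bar.induction (P := fun z => (φ ∘ₗ barMap f ∘ₗ φ) z = φ z) (by simp)
    (fun i z hz => ?_) (fun x y hx hy => by rw [map_add, hx, hy, map_add]) z
  obtain ⟨y, hy, hyz⟩ : ∃ y ∈ N.gr (i + n), N.barMk y = φ z := hφ i z hz
  have hfz : barMap f (φ z) = M.bar.proj i (barMap g (φ z)) := by
    rw [← hyz, barMap_barMk, hf _ y hy, barMk_proj, add_neg_cancel_right]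
    rfl
  calc φ (barMap f (φ z)) = N.bar.proj (i + n) ((φ ∘ₗ barMap g ∘ₗ φ) z) := by
        rw [hfz]
        exact map_proj φ.toAddMonoidHom n hφ i _
    _ = φ z := by rw [hψ, N.bar.proj_same (hφ i z hz)]

end Nonneg

/-! ### Homotopical minimality -/

theorem Hom.isIso_of_bijective (f : Hom M N) (hf : Function.Bijective f.toLin) : f.IsIso := by
  let e := LinearEquiv.ofBijective f.toLin hf
  have he : ∀ x, f.toLin (e.symm x) = x := e.apply_symm_apply
  refine ⟨⟨e.symm.toLinearMap, fun i m hm => mem_gr_iff_proj_eq.2 (hf.1 ?_),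
    fun m => hf.1 ?_⟩, ?_, ?_⟩
  · change f.toLin (M.proj i (e.symm m)) = f.toLin (e.symm m)
    rw [f.map_proj, he, N.proj_same hm]
  · change f.toLin (e.symm (N.d m)) = f.toLin (M.d (e.symm m))
    rw [f.map_d, he, he]
  · simp only [Hom.comp, Hom.id, Hom.mk.injEq]
    exact LinearMap.ext e.symm_apply_apply
  · simp only [Hom.comp, Hom.id, Hom.mk.injEq]
    exact LinearMap.ext he

theorem Hom.IsIso.bijective {f : Hom M N} (hf : f.IsIso) : Function.Bijective f.toLin := by
  obtain ⟨g, hgf, hfg⟩ := hf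
  exact Function.bijective_iff_has_inverse.2 ⟨g.toLin,
    LinearMap.congr_fun (congrArg Hom.toLin hgf), LinearMap.congr_fun (congrArg Hom.toLin hfg)⟩

theorem Hom.bijective_of_barMap_eq_id [𝒜.IsNonneg] (hM : M.IsBoundedBelow) (f : Hom M M)
    (hf : barMap f.toLin = LinearMap.id) : Function.Bijective f.toLin :=
  f.hasDegree.bijective_of_sub_mem hM fun x => by
    rw [← barMk_eq_zero, map_sub, sub_eq_zero]
    exact LinearMap.congr_fun hf (M.barMk x)

theorem Hom.IsHomotopyEquiv.isIso [𝒜.IsNonneg] (hM : M.IsBoundedBelow) (hN : N.IsBoundedBelow)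
    (hMd : M.IsMinimal) (hNd : N.IsMinimal) {f : Hom M N} (hf : f.IsHomotopyEquiv) : f.IsIso := by
  obtain ⟨g, hgf, hfg⟩ := hf
  have hgf' := (g.comp f).bijective_of_barMap_eq_id hM ((hgf.barMap_eq hMd hMd).trans barMap_id)
  have hfg' := (f.comp g).bijective_of_barMap_eq_id hN ((hfg.barMap_eq hNd hNd).trans barMap_id)
  exact f.isIso_of_bijective ⟨Function.Injective.of_comp (f := g.toLin) hgf'.1,
    Function.Surjective.of_comp (g := g.toLin) hfg'.2⟩

theorem IsMinimal.isHomotopicallyMinimal [𝒜.IsNonneg] (hd : M.IsMinimal)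
    (hM : M.IsBoundedBelow) : M.IsHomotopicallyMinimal :=
  fun _ hf => hf.isIso hM hM hd hd

/-! ### Homotopies -/

theorem Hom.ext_apply {f g : Hom M N} (h : ∀ x, f.toLin x = g.toLin x) : f = g := by
  cases f
  cases g
  simpa only [Hom.mk.injEq] using LinearMap.ext h

theorem Homotopic.refl (f : Hom M N) : Homotopic f f :=
  ⟨0, fun _ _ _ => zero_mem _, fun m => by simp⟩

theorem Homotopic.symm {f g : Hom M N} (h : Homotopic f g) : Homotopic g f := by
  obtain ⟨s, hdeg, hs⟩ := h
  refine ⟨-s, fun i m hm => neg_mem (hdeg i m hm), fun m => ?_⟩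
  rw [← neg_sub, hs, LinearMap.neg_apply, LinearMap.neg_apply, map_neg, neg_add]

theorem Homotopic.trans {f g e : Hom M N} (h : Homotopic f g) (h' : Homotopic g e) :
    Homotopic f e := by
  obtain ⟨s, hdeg, hs⟩ := h
  obtain ⟨s', hdeg', hs'⟩ := h'
  refine ⟨s + s', fun i m hm => add_mem (hdeg i m hm) (hdeg' i m hm), fun m => ?_⟩
  rw [← sub_add_sub_cancel _ (g.toLin m), hs, hs', LinearMap.add_apply, LinearMap.add_apply,
    map_add, add_add_add_comm]

theorem Homotopic.comp_left {f f' : Hom M N} (g : Hom N P) (h : Homotopic f f') :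
    Homotopic (g.comp f) (g.comp f') := by
  obtain ⟨s, hdeg, hs⟩ := h
  refine ⟨g.toLin.comp s, fun i m hm => g.map_mem _ _ (hdeg i m hm), fun m => ?_⟩
  simpa [Hom.comp, g.map_d] using congrArg g.toLin (hs m)

theorem Homotopic.comp_right {g g' : Hom N P} (h : Homotopic g g') (f : Hom M N) :
    Homotopic (g.comp f) (g'.comp f) := by
  obtain ⟨s, hdeg, hs⟩ := h
  refine ⟨s.comp f.toLin, fun i m hm => hdeg _ _ (f.map_mem i m hm), fun m => ?_⟩
  simpa [Hom.comp, f.map_d] using hs (f.toLin m)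

/-- The null-homotopic morphism `d h + h d` attached to an `A`-linear map `h` of degree `-1`. -/
def nullHom (h : M.carrier →ₗ[Aᵐᵒᵖ] N.carrier) (hdeg : HasDegree h (-1)) : Hom M N where
  toLin :=
    { toFun := fun x => N.d (h x) + h (M.d x)
      map_add' := fun x y => by simp only [map_add]; abel
      map_smul' := fun r x => by
        refine M.induction (P := fun x => N.d (h (r • x)) + h (M.d (r • x)) =
          r • (N.d (h x) + h (M.d x))) (by simp) (fun i m hm => ?_) (fun a b ha hb => ?_) x
        · have hM := M.leibniz i m r.unop hm
          have hN := N.leibniz (i - 1) (h m) r.unop (hdeg i m hm)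
          rw [MulOpposite.op_unop] at hM hN
          rw [map_smul, hM, hN, map_add, map_smul, smul_add, Int.negOnePow_sub,
            Int.negOnePow_one]
          rcases Int.units_eq_one_or i.negOnePow with hi | hi <;> simp [hi] <;> abel
        · simp only [smul_add, map_add] at ha hb ⊢
          rw [add_add_add_comm, ha, hb]
          abel }
  map_mem i m hm := by
    have hd := N.d_mem _ _ (hdeg i m hm)
    have hh := hdeg _ _ (M.d_mem i m hm)
    rw [neg_add_cancel_right] at hd
    rw [add_neg_cancel_right] at hh
    exact add_mem hd hh
  map_d m := by
    change N.d (h (M.d m)) + h (M.d (M.d m)) = N.d (N.d (h m) + h (M.d m))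
    rw [M.d_d, map_zero, map_add, N.d_d, zero_add, add_zero]

/-- The difference of two morphisms of dg modules. -/
def Hom.sub (f g : Hom M N) : Hom M N where
  toLin := f.toLin - g.toLin
  map_mem i m hm := sub_mem (f.map_mem i m hm) (g.map_mem i m hm)
  map_d m := by simp [f.map_d, g.map_d]

theorem homotopic_sub_nullHom (f : Hom M N) (h : M.carrier →ₗ[Aᵐᵒᵖ] N.carrier)
    (hdeg : HasDegree h (-1)) : Homotopic f (f.sub (nullHom h hdeg)) :=
  ⟨h, hdeg, fun _ => sub_sub_cancel _ _⟩

theorem Hom.map_negOnePow_smul_d (f : Hom M N) (n : ℤ) (m : M.carrier) :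
    f.toLin (n.negOnePow • M.d m) = n.negOnePow • N.d (f.toLin m) := by
  rcases Int.units_eq_one_or n.negOnePow with h | h <;> simp [h, f.map_d]

theorem HotIso.symm (h : HotIso M N) : HotIso N M := by
  obtain ⟨f, g, hgf, hfg⟩ := h
  exact ⟨g, f, hfg, hgf⟩

/-- `M` is a homotopy retract of `N`, i.e. a retract in `dgHot(𝒜)`. -/
def IsHomotopyRetract (M N : DGModule 𝒜) : Prop :=
  ∃ (i : Hom M N) (p : Hom N M), Homotopic (p.comp i) (Hom.id M)

theorem IsHomotopyRetract.trans (h : IsHomotopyRetract M N) (h' : IsHomotopyRetract N P) :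
    IsHomotopyRetract M P := by
  obtain ⟨i, p, h⟩ := h
  obtain ⟨j, q, h'⟩ := h'
  exact ⟨j.comp i, p.comp q, ((h'.comp_right i).comp_left p).trans h⟩

theorem HotIso.isHomotopyRetract (h : HotIso M N) : IsHomotopyRetract M N := by
  obtain ⟨f, g, hgf, _⟩ := h
  exact ⟨f, g, hgf⟩

theorem IsHomotopyRetract.shift (n : ℤ) (h : IsHomotopyRetract M N) :
    IsHomotopyRetract (DGModule.shift n M) (DGModule.shift n N) := by
  obtain ⟨i, p, h, hdeg, hh⟩ := h
  refine ⟨⟨i.toLin, fun j m hm => i.map_mem _ m hm, i.map_negOnePow_smul_d n⟩,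
    ⟨p.toLin, fun j m hm => p.map_mem _ m hm, p.map_negOnePow_smul_d n⟩,
    n.negOnePow.val • h, fun j m hm => ?_, fun m => ?_⟩
  · have := hdeg _ m hm
    rw [add_sub_right_comm] at this
    exact AddSubgroup.zsmul_mem _ this _
  · refine (hh m).trans ?_
    change _ = n.negOnePow • M.d (n.negOnePow.val • h m) +
      n.negOnePow.val • h (n.negOnePow • M.d m)
    rcases Int.units_eq_one_or n.negOnePow with hn | hn <;> simp [hn]

theorem isHomotopyRetract_prod (M N : DGModule 𝒜) : IsHomotopyRetract M (DGModule.prod M N) :=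
  ⟨⟨LinearMap.inl _ _ _, fun _ _ hm => ⟨hm, zero_mem _⟩,
      fun _ => Prod.ext rfl (map_zero N.d).symm⟩,
    ⟨LinearMap.fst _ _ _, fun _ _ hm => hm.1, fun _ => rfl⟩, Homotopic.refl _⟩

/-- The morphism of cones `(x, y) ↦ (b x + s y, a y)` induced by a square `(a, b)` that commutes
up to the homotopy `s`. -/
def coneMap {M M' N N' : DGModule 𝒜} {f : Hom M N} {g : Hom M' N'} (a : Hom M M') (b : Hom N N')
    (s : M.carrier →ₗ[Aᵐᵒᵖ] N'.carrier) (hdeg : HasDegree s (-1))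
    (hs : ∀ y, b.toLin (f.toLin y) - g.toLin (a.toLin y) = N'.d (s y) + s (M.d y)) :
    Hom (cone f) (cone g) where
  toLin := (b.toLin.coprod s).prod (a.toLin ∘ₗ LinearMap.snd Aᵐᵒᵖ N.carrier M.carrier)
  map_mem i x hx := by
    have := hdeg _ _ hx.2
    rw [add_neg_cancel_right] at this
    exact ⟨add_mem (b.map_mem _ _ hx.1) this, a.map_mem _ _ hx.2⟩
  map_d x := by
    refine Prod.ext ?_ ?_
    · change b.toLin (N.d x.1 + f.toLin x.2) + s (-M.d x.2) =
        N'.d (b.toLin x.1 + s x.2) + g.toLin (a.toLin x.2)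
      rw [map_add, map_add, map_neg, b.map_d, sub_eq_iff_eq_add.1 (hs x.2)]
      abel
    · change a.toLin (-M.d x.2) = -M'.d (a.toLin x.2)
      rw [map_neg, a.map_d]

theorem IsHomotopyRetract.cone {M M' N N' : DGModule 𝒜} (f : Hom M M')
    (h : IsHomotopyRetract M N) (h' : IsHomotopyRetract M' N') :
    ∃ g : Hom N N', IsHomotopyRetract (DGModule.cone f) (DGModule.cone g) := by
  obtain ⟨i, p, h, hdeg, hh⟩ := h
  obtain ⟨i', p', h', hdeg', hh'⟩ := h'
  have d_h (m) : M.d (h m) = p.toLin (i.toLin m) - m - h (M.d m) := eq_sub_of_add_eq (hh m).symm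
  have d_h' (m) : M'.d (h' m) = p'.toLin (i'.toLin m) - m - h' (M'.d m) :=
    eq_sub_of_add_eq (hh' m).symm
  let incl := coneMap (f := f) (g := i'.comp (f.comp p)) i i' (-(i'.toLin ∘ₗ f.toLin ∘ₗ h))
    (fun j m hm => neg_mem (i'.map_mem _ _ (f.map_mem _ _ (hdeg j m hm)))) fun y => by
      change i'.toLin (f.toLin y) - i'.toLin (f.toLin (p.toLin (i.toLin y))) =
        N'.d (-i'.toLin (f.toLin (h y))) + -i'.toLin (f.toLin (h (M.d y)))
      simp only [map_neg, ← Hom.map_d, d_h, map_sub]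
      abel
  let proj := coneMap (f := i'.comp (f.comp p)) (g := f) p p' (h' ∘ₗ f.toLin ∘ₗ p.toLin)
    (fun j m hm => hdeg' _ _ (f.map_mem _ _ (p.map_mem _ _ hm))) fun y => by
      change p'.toLin (i'.toLin (f.toLin (p.toLin y))) - f.toLin (p.toLin y) =
        M'.d (h' (f.toLin (p.toLin y))) + h' (f.toLin (p.toLin (N.d y)))
      simp only [d_h', Hom.map_d]
      abel
  let s : M'.carrier × M.carrier →ₗ[Aᵐᵒᵖ] M'.carrier × M.carrier :=
    (h'.coprod (-(h' ∘ₗ f.toLin ∘ₗ h))).prod (-(h ∘ₗ LinearMap.snd Aᵐᵒᵖ M'.carrier M.carrier))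
  refine ⟨_, incl, proj, s, fun j x hx => ?_, fun x => Prod.ext ?_ ?_⟩
  · have hj := hdeg _ _ hx.2
    have hj' := add_sub_cancel_right j 1 ▸ hj
    rw [add_sub_right_comm] at hj
    exact ⟨add_mem (hdeg' _ _ hx.1) ((M'.gr (j - 1)).neg_mem (hdeg' _ _ (f.map_mem _ _ hj'))),
      (M.gr (j - 1 + 1)).neg_mem hj⟩
  · change p'.toLin (i'.toLin x.1 + -i'.toLin (f.toLin (h x.2))) +
        h' (f.toLin (p.toLin (i.toLin x.2))) - x.1 =
      M'.d (h' x.1 + -h' (f.toLin (h x.2))) + f.toLin (-h x.2) +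
        (h' (M'.d x.1 + f.toLin x.2) + -h' (f.toLin (h (-M.d x.2))))
    simp only [map_add, map_sub, map_neg, d_h', ← Hom.map_d, d_h]
    abel
  · change p.toLin (i.toLin x.2) - x.2 = -M.d (-h x.2) + -h (-M.d x.2)
    simp only [map_neg, d_h]
    abel

/-! ### Lifting idempotents -/

/-- The ring of endomorphisms of `M` in `dgMod`, as a subring of the ring of all `A`-linear
endomorphisms. -/
def dgEnd (M : DGModule 𝒜) : Subring (Module.End Aᵐᵒᵖ M.carrier) where
  carrier := {f | HasDegree f 0 ∧ ∀ x, f (M.d x) = M.d (f x)}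
  mul_mem' hf hg := ⟨hf.1.comp hg.1, fun x => by
    rw [Module.End.mul_apply, hg.2, hf.2, Module.End.mul_apply]⟩
  one_mem' := ⟨(Hom.id M).hasDegree, fun _ => rfl⟩
  add_mem' hf hg := ⟨fun i m hm => add_mem (hf.1 i m hm) (hg.1 i m hm), fun x => by
    rw [LinearMap.add_apply, hf.2, hg.2, LinearMap.add_apply, map_add]⟩
  zero_mem' := ⟨fun _ _ _ => zero_mem _, fun _ => (map_zero M.d).symm⟩
  neg_mem' hf := ⟨fun i m hm => neg_mem (hf.1 i m hm), fun x => by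
    rw [LinearMap.neg_apply, hf.2, LinearMap.neg_apply, map_neg]⟩

/-- An element of the endomorphism ring as a morphism of dg modules. -/
def dgEnd.toHom (f : M.dgEnd) : Hom M M where
  toLin := f.1
  map_mem i m hm := add_zero i ▸ f.2.1 i m hm
  map_d := f.2.2

/-- A morphism `M → M` of dg modules as an element of the endomorphism ring. -/
def Hom.toDgEnd (f : Hom M M) : M.dgEnd := ⟨f.toLin, f.hasDegree, f.map_d⟩

theorem Homotopic.add {e f e' f' : M.dgEnd} (h : Homotopic (dgEnd.toHom e) (dgEnd.toHom f))
    (h' : Homotopic (dgEnd.toHom e') (dgEnd.toHom f')) :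
    Homotopic (dgEnd.toHom (e + e')) (dgEnd.toHom (f + f')) := by
  obtain ⟨s, hdeg, hs⟩ := h
  obtain ⟨s', hdeg', hs'⟩ := h'
  refine ⟨s + s', fun i m hm => add_mem (hdeg i m hm) (hdeg' i m hm), fun m => ?_⟩
  change (e.1 m + e'.1 m) - (f.1 m + f'.1 m) = _
  rw [add_sub_add_comm, LinearMap.add_apply, LinearMap.add_apply, map_add, add_add_add_comm]
  exact congrArg₂ (· + ·) (hs m) (hs' m)

/-- Homotopy as a congruence of the ring of endomorphisms; the quotient is the ring of
endomorphisms of `M` in `dgHot`. -/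
def homotopyCon (M : DGModule 𝒜) : RingCon M.dgEnd where
  r f g := Homotopic (dgEnd.toHom f) (dgEnd.toHom g)
  iseqv := ⟨fun _ => Homotopic.refl _, Homotopic.symm, Homotopic.trans⟩
  add' := Homotopic.add
  mul' h h' := (h'.comp_left _).trans (h.comp_right _)

/-- The action of endomorphisms on `M̄`. -/
def barMapHom (M : DGModule 𝒜) : M.dgEnd →+* Module.End 𝒜.A0ᵐᵒᵖ M.bar.carrier where
  toFun f := barMap f.1
  map_one' := barMap_id
  map_mul' f g := barMap_comp f.1 g.1
  map_zero' := bar_hom_ext fun _ => map_zero M.barMk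
  map_add' f g := barMap_add f.1 g.1

theorem isNilpotent_of_barMapHom_eq_zero [𝒜.IsNonneg] [Module.Finite Aᵐᵒᵖ M.carrier]
    {f : M.dgEnd} (hf : M.barMapHom f = 0) : IsNilpotent f := by
  have hf' : ∀ x, f.1 x ∈ M.smulGE Set.univ 1 := fun x =>
    barMk_eq_zero.1 (LinearMap.congr_fun hf (M.barMk x))
  obtain ⟨n, hn⟩ := isNilpotent_of_forall_exists_pow_apply_eq_zero
    (HasDegree.exists_pow_apply_eq_zero isBoundedBelow_of_finite f.2.1 hf')
  exact ⟨n, Subtype.ext hn⟩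

/-- Idempotents lift along the ring homomorphism that sends an endomorphism to its homotopy class
and to its action on `M̄`, because its kernel is nil. -/
theorem exists_idempotent_homotopic [𝒜.IsNonneg] [Module.Finite Aᵐᵒᵖ M.carrier] {e : Hom M M}
    (he : Homotopic (e.comp e) e) (hbar : IsIdempotentElem (M := Module.End 𝒜.A0ᵐᵒᵖ M.bar.carrier)
      (barMap e.toLin)) :
    ∃ e' : Hom M M, e'.comp e' = e' ∧ Homotopic e' e ∧ barMap e'.toLin = barMap e.toLin := by
  let F := M.homotopyCon.mk'.prod M.barMapHom
  obtain ⟨e', he', hFe⟩ := exists_isIdempotentElem_eq_of_ker_isNilpotent F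
    (fun f hf => isNilpotent_of_barMapHom_eq_zero (congrArg Prod.snd hf)) (F e.toDgEnd)
    ⟨_, rfl⟩ (Prod.ext ((RingCon.eq M.homotopyCon).2 he) hbar)
  exact ⟨dgEnd.toHom e', Hom.ext_apply (LinearMap.congr_fun (congrArg Subtype.val he')),
    (RingCon.eq M.homotopyCon).1 (congrArg Prod.fst hFe), congrArg Prod.snd hFe⟩

/-- The image of a morphism of dg modules. -/
def Hom.range (f : Hom M N) : DGSub N where
  toSubmodule := LinearMap.range f.toLin
  proj_mem := by
    rintro i _ ⟨x, rfl⟩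
    exact ⟨M.proj i x, f.map_proj i x⟩
  d_mem := by
    rintro _ ⟨x, rfl⟩
    exact ⟨M.d x, f.map_d x⟩

theorem exists_splitting {e : Hom M M} (he : e.comp e = e) :
    ∃ (N : DGModule 𝒜) (i : Hom N M) (p : Hom M N), p.comp i = Hom.id N ∧ i.comp p = e := by
  refine ⟨e.range.toDGModule, ⟨e.range.toSubmodule.subtype, fun _ _ h => h, fun _ => rfl⟩,
    ⟨e.toLin.rangeRestrict, e.map_mem, fun m => Subtype.ext (e.map_d m)⟩,
    Hom.ext_apply ?_, rfl⟩
  rintro ⟨_, x, rfl⟩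
  exact Subtype.ext (LinearMap.congr_fun (congrArg Hom.toLin he) x)

theorem exists_homotopic_id_barD_comp_eq_zero [𝒜.IsNonneg] [IsSemisimpleRing 𝒜.A0]
    [Module.Projective Aᵐᵒᵖ M.carrier] :
    ∃ e : Hom M M, Homotopic e (Hom.id M) ∧ M.barD ∘ₗ barMap e.toLin = 0 ∧
      IsIdempotentElem (M := Module.End 𝒜.A0ᵐᵒᵖ M.bar.carrier) (barMap e.toLin) := by
  -- With `κ` a lift of a quasi-inverse of the differential of `M̄`, the map `t = 1 - (d κ + κ d)`
  -- is homotopic to the identity and `M̄.d ∘ t̄ = 0`; only its square is idempotent on `M̄`.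
  obtain ⟨κ, hdeg, hκ⟩ := exists_hasDegree_quasiInverse M.barD M.bar.d_mem
  let t : Hom M M := (Hom.id M).sub (nullHom κ hdeg)
  have ht : Homotopic t (Hom.id M) := (homotopic_sub_nullHom (Hom.id M) κ hdeg).symm
  let δ : Module.End 𝒜.A0ᵐᵒᵖ M.bar.carrier := M.barD
  let σ : Module.End 𝒜.A0ᵐᵒᵖ M.bar.carrier := barMap κ
  have hδ : δ * δ = 0 := M.barD_comp_barD
  have hbar : barMap t.toLin = 1 - (δ * σ + σ * δ) := by
    refine bar_hom_ext fun x => ?_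
    change M.barMk (x - (M.d (κ x) + κ (M.d x))) = _
    rw [map_sub, map_add]
    rfl
  have hcomp : barMap (t.comp t).toLin =
      (1 - (δ * σ + σ * δ)) * (1 - (δ * σ + σ * δ)) := by
    rw [← hbar]
    exact barMap_comp t.toLin t.toLin
  refine ⟨t.comp t, (ht.comp_left t).trans ht, ?_, ?_⟩
  · rw [hcomp]
    change δ * _ = 0
    rw [← mul_assoc, mul_one_sub_contraction hδ hκ, zero_mul]
  · rw [hcomp]
    exact isIdempotentElem_one_sub_contraction_sq hδ hκ

theorem exists_minimal_retract [𝒜.IsNonneg] [IsSemisimpleRing 𝒜.A0]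
    [Module.Finite Aᵐᵒᵖ M.carrier] [Module.Projective Aᵐᵒᵖ M.carrier] :
    ∃ (N : DGModule 𝒜) (i : Hom N M) (p : Hom M N), p.comp i = Hom.id N ∧
      Homotopic (i.comp p) (Hom.id M) ∧ N.IsMinimal := by
  obtain ⟨e, he, hde, hidem⟩ := exists_homotopic_id_barD_comp_eq_zero (M := M)
  obtain ⟨e', hidem', he', hbar⟩ := exists_idempotent_homotopic (he.comp_left e) hidem
  obtain ⟨N, i, p, hpi, rfl⟩ := exists_splitting hidem'
  have hpi' : ∀ x, p.toLin (i.toLin x) = x := LinearMap.congr_fun (congrArg Hom.toLin hpi)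
  refine ⟨N, i, p, hpi, he'.trans he, fun x => ?_⟩
  have hix : M.d (i.toLin x) ∈ M.smulGE Set.univ 1 := by
    rw [← barMk_eq_zero, ← barD_barMk]
    calc M.barD (M.barMk (i.toLin x))
        = M.barD (barMap (i.comp p).toLin (M.barMk (i.toLin x))) := by
          rw [barMap_barMk]
          change _ = M.barD (M.barMk (i.toLin (p.toLin (i.toLin x))))
          rw [hpi']
      _ = 0 := by
          rw [hbar, ← LinearMap.comp_apply, hde, LinearMap.zero_apply]
  simpa only [p.map_d, hpi'] using map_mem_smulGE_univ p.toLin hix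

/-! ### Minimal cells -/

/-- The submodule `Y A^+ + M A^{≥ 2}` of `M` attached to a submodule `Y` of `M̄`; it is well
defined because `M A^+ A^+ ⊆ M A^{≥ 2}`. -/
def liftAPlus (M : DGModule 𝒜) (Y : Submodule 𝒜.A0ᵐᵒᵖ M.bar.carrier) : Submodule Aᵐᵒᵖ M.carrier :=
  M.smulGE (M.barMk ⁻¹' Y) 1 ⊔ M.smulGE Set.univ 2

theorem map_mem_liftAPlus (f : M.carrier →ₗ[Aᵐᵒᵖ] N.carrier)
    {Y : Submodule 𝒜.A0ᵐᵒᵖ M.bar.carrier} {Z : Submodule 𝒜.A0ᵐᵒᵖ N.bar.carrier}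
    (h : Y ≤ Z.comap (barMap f)) {x : M.carrier} (hx : x ∈ M.liftAPlus Y) :
    f x ∈ N.liftAPlus Z := by
  obtain ⟨y, hy, z, hz, rfl⟩ := Submodule.mem_sup.1 hx
  rw [map_add]
  exact add_mem (Submodule.mem_sup_left (map_smulGE_le f (fun y hy => h hy) 1 ⟨y, hy, rfl⟩))
    (Submodule.mem_sup_right (map_mem_smulGE_univ f hz))

theorem mem_liftAPlus_comap [𝒜.IsNonneg] [IsSemisimpleRing 𝒜.A0]
    [Module.Projective Aᵐᵒᵖ N.carrier] (g : M.carrier →ₗ[Aᵐᵒᵖ] N.carrier)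
    {Y : Submodule 𝒜.A0ᵐᵒᵖ N.bar.carrier} {x : M.carrier} (hx : x ∈ M.smulGE Set.univ 1)
    (hgx : g x ∈ N.liftAPlus Y) : x ∈ M.liftAPlus (Y.comap (barMap g)) := by
  obtain ⟨ψ, hψ⟩ := exists_comp_comp_eq_self (Y.mkQ ∘ₗ barMap g)
  obtain ⟨f, hf⟩ := exists_barMap_eq (ψ ∘ₗ Y.mkQ)
  have hsub : x - f (g x) ∈ M.liftAPlus (Y.comap (barMap g)) := by
    refine Submodule.mem_sup_left (map_smulGE_le (LinearMap.id - f ∘ₗ g) (fun y _ => ?_) 1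
      ⟨x, hx, rfl⟩)
    change barMap g (M.barMk (y - f (g y))) ∈ Y
    rw [map_sub, ← barMap_barMk, ← barMap_barMk, hf, map_sub, ← Submodule.Quotient.mk_eq_zero,
      Submodule.Quotient.mk_sub, sub_eq_zero]
    exact (LinearMap.congr_fun hψ (M.barMk y)).symm
  have hfg : f (g x) ∈ M.liftAPlus (Y.comap (barMap g)) := by
    refine map_mem_liftAPlus f (fun z hz => ?_) hgx
    have : Y.mkQ z = 0 := (Submodule.Quotient.mk_eq_zero Y).2 hz
    rw [Submodule.mem_comap, hf, LinearMap.comp_apply, this, map_zero]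
    exact zero_mem _
  rw [← sub_add_cancel x (f (g x))]
  exact add_mem hsub hfg

/-- The submodules of `M̄` on which the map `M̄ → M A^+ / M A^{≥ 2}` induced by the differential
of a minimal dg module `M` is nilpotent: they have a finite filtration each of whose steps is
mapped into the product of the preceding step with `A^+`. -/
inductive IsNilSub (M : DGModule 𝒜) : Submodule 𝒜.A0ᵐᵒᵖ M.bar.carrier → Prop
  | bot : IsNilSub M ⊥
  | step {Y Z : Submodule 𝒜.A0ᵐᵒᵖ M.bar.carrier} :
      IsNilSub M Y → (∀ x, M.barMk x ∈ Z → M.d x ∈ M.liftAPlus Y) → IsNilSub M Z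

namespace IsNilSub

theorem anti {Y Z : Submodule 𝒜.A0ᵐᵒᵖ M.bar.carrier} (h : IsNilSub M Y) (hZ : Z ≤ Y) :
    IsNilSub M Z := by
  cases h with
  | bot => exact le_bot_iff.1 hZ ▸ .bot
  | step h hd => exact .step h fun x hx => hd x (hZ hx)

theorem map [𝒜.IsNonneg] (hN : N.IsMinimal) (j : M.carrier →ₗ[Aᵐᵒᵖ] N.carrier) (ε : ℤˣ)
    (hj : ∀ x, N.d (j x) = ε • j (M.d x)) {Y : Submodule 𝒜.A0ᵐᵒᵖ M.bar.carrier}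
    (h : IsNilSub M Y) : IsNilSub N (Y.map (barMap j)) := by
  induction h with
  | bot => exact (Submodule.map_bot (barMap j)).symm ▸ .bot
  | @step Y Z _ hd ih =>
    refine .step ih fun x hx => ?_
    obtain ⟨z, hz, hzx⟩ := hx
    obtain ⟨y, rfl⟩ := M.barMk_surjective z
    have hxy : x - j y ∈ N.smulGE Set.univ 1 := by
      rw [← barMk_eq_zero, map_sub, ← barMap_barMk, hzx, sub_self]
    rw [← sub_add_cancel x (j y), map_add, hj]
    exact add_mem (Submodule.mem_sup_right (hN.d_mem_smulGE_two hxy))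
      (intUnits_smul_mem ε (map_mem_liftAPlus j (Submodule.le_comap_map _ _) (hd y hz)))

theorem comap [𝒜.IsNonneg] [IsSemisimpleRing 𝒜.A0] [Module.Projective Aᵐᵒᵖ N.carrier]
    (hM : M.IsMinimal) (g : Hom M N) (hg : IsNilSub M (LinearMap.ker (barMap g.toLin)))
    {Y : Submodule 𝒜.A0ᵐᵒᵖ N.bar.carrier} (h : IsNilSub N Y) :
    IsNilSub M (Y.comap (barMap g.toLin)) := by
  induction h with
  | bot => exact hg
  | step _ hd ih =>
    exact .step ih fun x hx => mem_liftAPlus_comap g.toLin (hM x) (g.map_d x ▸ hd _ hx)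

theorem of_exact [𝒜.IsNonneg] [IsSemisimpleRing 𝒜.A0] [Module.Projective Aᵐᵒᵖ P.carrier]
    (hN : N.IsMinimal) (j : Hom M N) (g : Hom N P)
    (h : LinearMap.ker (barMap g.toLin) ≤ LinearMap.range (barMap j.toLin))
    (hM : IsNilSub M ⊤) (hP : IsNilSub P ⊤) : IsNilSub N ⊤ := by
  have hj := hM.map hN j.toLin 1 fun x => by rw [one_smul, j.map_d]
  rw [Submodule.map_top] at hj
  exact comap hN g (hj.anti h) hP

end IsNilSub

/-- The inclusion `N → cone f` of the target of `f`. -/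
def coneInl (f : Hom M N) : Hom N (cone f) where
  toLin := LinearMap.inl Aᵐᵒᵖ N.carrier M.carrier
  map_mem i _ hx := ⟨hx, (M.gr (i + 1)).zero_mem⟩
  map_d x := Prod.ext (show N.d x = N.d x + f.toLin 0 by rw [map_zero, add_zero])
    (show 0 = -M.d 0 by rw [map_zero, neg_zero])

/-- The projection `cone f → {1} M` onto the shifted source of `f`. -/
def coneSnd (f : Hom M N) : Hom (cone f) (shift 1 M) where
  toLin := LinearMap.snd Aᵐᵒᵖ N.carrier M.carrier
  map_mem _ _ hx := hx.2
  map_d x := show -M.d x.2 = Int.negOnePow 1 • M.d x.2 by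
    rw [Int.negOnePow_one, Units.neg_smul, one_smul]

theorem ker_barMap_coneSnd_comp_le {f : Hom M N} {i : P.carrier →ₗ[Aᵐᵒᵖ] (cone f).carrier}
    {p : (cone f).carrier →ₗ[Aᵐᵒᵖ] P.carrier} (h : p ∘ₗ i = LinearMap.id) :
    LinearMap.ker (barMap ((coneSnd f).toLin ∘ₗ i)) ≤
      LinearMap.range (barMap (p ∘ₗ (coneInl f).toLin)) := by
  let inr : M.carrier →ₗ[Aᵐᵒᵖ] (cone f).carrier := LinearMap.inr Aᵐᵒᵖ N.carrier M.carrier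
  have hsum : ∀ x : (cone f).carrier, (coneInl f).toLin x.1 + inr x.2 = x := fun x =>
    Prod.ext (add_zero x.1) (zero_add x.2)
  intro z hz
  obtain ⟨x, rfl⟩ := P.barMk_surjective z
  have hx : (i x).2 ∈ M.smulGE Set.univ 1 :=
    barMk_eq_zero (M := shift 1 M).1 (LinearMap.mem_ker.1 hz)
  have hpx : P.barMk (p (inr (i x).2)) = 0 :=
    barMk_eq_zero.2 (map_mem_smulGE_univ (p ∘ₗ inr) hx)
  refine ⟨N.barMk (i x).1, ?_⟩
  calc P.barMk (p ((coneInl f).toLin (i x).1))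
      = P.barMk (p ((coneInl f).toLin (i x).1)) + P.barMk (p (inr (i x).2)) := by
        rw [hpx, add_zero]
    _ = P.barMk (p (i x)) := by rw [← map_add, ← map_add, hsum]
    _ = P.barMk x := congrArg P.barMk (LinearMap.congr_fun h x)

/-- Finitely generated projective minimal dg modules on which the differential is nilpotent modulo
`A^{≥ 2}`. -/
structure IsMinimalCell (M : DGModule 𝒜) : Prop where
  finite : Module.Finite Aᵐᵒᵖ M.carrier
  projective : Module.Projective Aᵐᵒᵖ M.carrier
  isMinimal : M.IsMinimal
  isNilSub_top : IsNilSub M ⊤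

namespace IsMinimalCell

theorem of_split [𝒜.IsNonneg] (hM : IsMinimalCell M) (p : Hom M N)
    {s : N.carrier →ₗ[Aᵐᵒᵖ] M.carrier} (h : p.toLin ∘ₗ s = LinearMap.id) : IsMinimalCell N := by
  have hps : ∀ x, p.toLin (s x) = x := LinearMap.congr_fun h
  have hsurj : Function.Surjective p.toLin := fun x => ⟨_, hps x⟩
  have hN : N.IsMinimal := fun x => by
    simpa only [p.map_d, hps] using map_mem_smulGE_univ p.toLin (hM.isMinimal (s x))
  have := hM.finite
  have := hM.projective
  refine ⟨.of_surjective p.toLin hsurj, .of_split s p.toLin h, hN, ?_⟩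
  refine (hM.isNilSub_top.map hN p.toLin 1 fun x => by rw [one_smul, p.map_d]).anti
    fun z _ => ⟨barMap s z, trivial, ?_⟩
  rw [← LinearMap.comp_apply, ← barMap_comp, h, barMap_id, LinearMap.id_apply]

theorem shift [𝒜.IsNonneg] (n : ℤ) (hM : IsMinimalCell M) :
    IsMinimalCell (DGModule.shift n M) := by
  have hmin : (DGModule.shift n M).IsMinimal := fun x =>
    intUnits_smul_mem (s := M.smulGE Set.univ 1) n.negOnePow (hM.isMinimal x)
  let j : M.carrier →ₗ[Aᵐᵒᵖ] (DGModule.shift n M).carrier := LinearMap.id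
  refine ⟨hM.finite, hM.projective, hmin,
    (hM.isNilSub_top.map hmin j n.negOnePow fun _ => rfl).anti fun z _ => ?_⟩
  obtain ⟨x, rfl⟩ := (DGModule.shift n M).barMk_surjective z
  exact ⟨M.barMk x, trivial, rfl⟩

theorem regular [𝒜.IsNonneg] (h0 : ∀ a ∈ 𝒜.gr 0, 𝒜.d a = 0) :
    IsMinimalCell (DGModule.regular 𝒜) := by
  let e : Aᵐᵒᵖ ≃ₗ[Aᵐᵒᵖ] (DGModule.regular 𝒜).carrier :=
    { MulOpposite.opAddEquiv.symm with map_smul' := fun _ _ => rfl }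
  have hd : ∀ a : A, 𝒜.d a ∈ (DGModule.regular 𝒜).smulGE Set.univ 2 := by
    refine 𝒜.nonneg_induction ?_ (fun i hi a ha => ?_) (fun a b ha hb => ?_)
    · rw [map_zero]
      exact zero_mem ((DGModule.regular 𝒜).smulGE Set.univ 2)
    · rcases hi.eq_or_lt with rfl | hi
      · rw [h0 a ha]
        exact zero_mem ((DGModule.regular 𝒜).smulGE Set.univ 2)
      · rw [← one_mul (𝒜.d a)]
        exact smul_mem_smulGE (M := DGModule.regular 𝒜) (by omega) (𝒜.d_mem i a ha) trivial
    · rw [map_add]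
      exact ((DGModule.regular 𝒜).smulGE Set.univ 2).add_mem ha hb
  exact ⟨.equiv e, .of_equiv e, fun x => smulGE_mono le_rfl one_le_two (hd x),
    .step .bot fun z _ => Submodule.mem_sup_right (hd z)⟩

theorem exists_cone [𝒜.IsNonneg] [IsSemisimpleRing 𝒜.A0] (f : Hom M N) (hM : IsMinimalCell M)
    (hN : IsMinimalCell N) : ∃ E, IsMinimalCell E ∧ IsHomotopyRetract (cone f) E := by
  have := hM.finite
  have := hM.projective
  have := hN.finite
  have := hN.projective
  have : Module.Finite Aᵐᵒᵖ (cone f).carrier :=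
    inferInstanceAs (Module.Finite Aᵐᵒᵖ (N.carrier × M.carrier))
  have : Module.Projective Aᵐᵒᵖ (cone f).carrier :=
    inferInstanceAs (Module.Projective Aᵐᵒᵖ (N.carrier × M.carrier))
  have : Module.Projective Aᵐᵒᵖ (DGModule.shift 1 M).carrier := hM.projective
  obtain ⟨E, i, p, hpi, hip, hE⟩ := exists_minimal_retract (M := cone f)
  have hpi' : p.toLin ∘ₗ i.toLin = LinearMap.id := congrArg Hom.toLin hpi
  refine ⟨E, ⟨.of_surjective p.toLin fun x => ⟨_, LinearMap.congr_fun hpi' x⟩,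
    .of_split i.toLin p.toLin hpi', hE, ?_⟩, p, i, hip⟩
  exact .of_exact hE (p.comp (coneInl f)) ((coneSnd f).comp i) (ker_barMap_coneSnd_comp_le hpi')
    hN.isNilSub_top (hM.shift 1).isNilSub_top

end IsMinimalCell

theorem IsPerfect.exists_isHomotopyRetract [𝒜.IsNonneg] [IsSemisimpleRing 𝒜.A0]
    (h0 : ∀ a ∈ 𝒜.gr 0, 𝒜.d a = 0) (hM : M.IsPerfect) :
    ∃ N, IsMinimalCell N ∧ IsHomotopyRetract M N := by
  induction hM with
  | regular => exact ⟨_, .regular h0, Hom.id _, Hom.id _, Homotopic.refl _⟩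
  | iso _ h ih =>
    obtain ⟨P, hP, hr⟩ := ih
    exact ⟨P, hP, h.symm.isHomotopyRetract.trans hr⟩
  | shift n _ ih =>
    obtain ⟨P, hP, hr⟩ := ih
    exact ⟨_, hP.shift n, hr.shift n⟩
  | cone f _ _ ih ih' =>
    obtain ⟨P, hP, hr⟩ := ih
    obtain ⟨P', hP', hr'⟩ := ih'
    obtain ⟨g, hg⟩ := IsHomotopyRetract.cone f hr hr'
    obtain ⟨E, hE, hgE⟩ := hP.exists_cone g hP'
    exact ⟨E, hE, hg.trans hgE⟩
  | @summand M M' _ ih =>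
    obtain ⟨P, hP, hr⟩ := ih
    exact ⟨P, hP, (isHomotopyRetract_prod M M').trans hr⟩

theorem IsHomotopyRetract.exists_hotIso [𝒜.IsNonneg] (hN : IsMinimalCell N)
    (h : IsHomotopyRetract M N) : ∃ P, IsMinimalCell P ∧ HotIso M P := by
  obtain ⟨i, p, h⟩ := h
  have := hN.finite
  have hidem : Homotopic ((i.comp p).comp (i.comp p)) (i.comp p) :=
    (h.comp_right p).comp_left i
  obtain ⟨e, he, hei, _⟩ := exists_idempotent_homotopic hidem
    ((barMap_comp _ _).symm.trans (hidem.barMap_eq hN.isMinimal hN.isMinimal))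
  obtain ⟨P, j, r, hrj, rfl⟩ := exists_splitting he
  refine ⟨P, hN.of_split r (congrArg Hom.toLin hrj), r.comp i, p.comp j, ?_, ?_⟩
  · have hpi : Homotopic (p.comp ((j.comp r).comp i)) (p.comp ((i.comp p).comp i)) :=
      (hei.comp_right i).comp_left p
    exact hpi.trans (Homotopic.trans (g := p.comp i) ((h.comp_left i).comp_left p) h)
  · have hjr : Homotopic (r.comp ((i.comp p).comp j)) (r.comp ((j.comp r).comp j)) :=
      (hei.symm.comp_right j).comp_left r
    have hid : r.comp ((j.comp r).comp j) = Hom.id P := by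
      change (r.comp j).comp (r.comp j) = Hom.id P
      rw [hrj]
      rfl
    exact hid ▸ hjr

theorem IsPerfect.exists_hotIso [𝒜.IsNonneg] [IsSemisimpleRing 𝒜.A0]
    (h0 : ∀ a ∈ 𝒜.gr 0, 𝒜.d a = 0) (hM : M.IsPerfect) : ∃ N, IsMinimalCell N ∧ HotIso M N := by
  obtain ⟨N, hN, h⟩ := hM.exists_isHomotopyRetract h0
  exact h.exists_hotIso hN

theorem IsMinimalCell.isHomotopicallyMinimal [𝒜.IsNonneg] (hM : IsMinimalCell M) :
    M.IsHomotopicallyMinimal :=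
  have := hM.finite
  hM.isMinimal.isHomotopicallyMinimal isBoundedBelow_of_finite

theorem IsHomotopicallyMinimal.isMinimalCell [𝒜.IsNonneg] (hM : M.IsHomotopicallyMinimal)
    (hN : IsMinimalCell N) (h : HotIso M N) : IsMinimalCell M := by
  obtain ⟨f, g, hgf, hfg⟩ := h
  have hgf' := (hM (g.comp f) ⟨Hom.id M, hgf, hgf⟩).bijective
  have hfg' := (hN.isHomotopicallyMinimal (f.comp g) ⟨Hom.id N, hfg, hfg⟩).bijective
  obtain ⟨f', hf', _⟩ := f.isIso_of_bijective
    ⟨Function.Injective.of_comp (f := g.toLin) hgf'.1,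
      Function.Surjective.of_comp (g := g.toLin) hfg'.2⟩
  exact hN.of_split f' (congrArg Hom.toLin hf')

/-! ### The submodules `M_{≤ i}` -/

theorem mem_le {i j : ℤ} (h : j ≤ i) {m : M.carrier} (hm : m ∈ M.gr j) : m ∈ M.le i :=
  Submodule.subset_span ⟨j, h, hm⟩

theorem le_mono {i j : ℤ} (h : i ≤ j) : M.le i ≤ M.le j :=
  Submodule.span_mono fun _ ⟨s, hs, hm⟩ => ⟨s, hs.trans h, hm⟩

theorem le_induction {i : ℤ} {P : M.carrier → Prop} (zero : P 0)
    (add : ∀ x y, P x → P y → P (x + y))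
    (smul : ∀ j ≤ i, ∀ m ∈ M.gr j, ∀ l, ∀ a ∈ 𝒜.gr l, P (MulOpposite.op a • m))
    {x : M.carrier} (hx : x ∈ M.le i) : P x := by
  induction hx using Submodule.closure_induction with
  | zero => exact zero
  | add x y _ _ hx hy => exact add x y hx hy
  | smul_mem r s hs =>
    obtain ⟨j, hj, hs⟩ := hs
    refine 𝒜.induction (P := fun a => P (MulOpposite.op a • s)) (by simpa using zero)
      (fun l a ha => smul j hj s hs l a ha) (fun a b ha hb => ?_) r.unop
    rw [MulOpposite.op_add, add_smul]
    exact add _ _ ha hb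

theorem mem_smulGE_of_mem_le {i j : ℤ} (h : i < j) {x : M.carrier} (hx : x ∈ M.le i)
    (hxj : x ∈ M.gr j) : x ∈ M.smulGE Set.univ 1 := by
  rw [← M.proj_same hxj]
  refine le_induction (P := fun x => M.proj j x ∈ M.smulGE Set.univ 1) (by simp)
    (fun x y hx hy => ?_) (fun s hs m hm l a ha => ?_) hx
  · rw [map_add]
    exact add_mem hx hy
  · rw [M.proj_smul ha]
    by_cases hsl : s = j - l
    · exact smul_mem_smulGE (by omega) ha trivial
    · rw [M.proj_ne hsl hm, smul_zero]
      exact zero_mem _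

theorem mem_le_of_mem_smulGE [𝒜.IsNonneg] {i : ℤ} {x : M.carrier}
    (hx : x ∈ M.smulGE Set.univ 1) (hxi : x ∈ M.gr (i + 1)) : x ∈ M.le i := by
  rw [← M.proj_same hxi]
  refine smulGE_induction (P := fun x => M.proj (i + 1) x ∈ M.le i) (by simp)
    (fun x y hx hy => ?_) (fun j hj a ha y _ => ?_) hx
  · rw [map_add]
    exact add_mem hx hy
  · rw [M.proj_smul ha]
    exact Submodule.smul_mem _ _ (mem_le (by omega) (M.proj_mem _ y))

theorem isMinimal_iff_d_mem_le [𝒜.IsNonneg] :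
    M.IsMinimal ↔ ∀ i, ∀ m ∈ M.le i, M.d m ∈ M.le i := by
  constructor
  · intro h i m hm
    refine le_induction (P := fun x => M.d x ∈ M.le i) (by simp) (fun x y hx hy => ?_)
      (fun j hj m hm l a _ => ?_) hm
    · rw [map_add]
      exact add_mem hx hy
    · rw [M.leibniz j m a hm]
      have hd : M.d m ∈ M.le i := le_mono hj (mem_le_of_mem_smulGE (h m) (M.d_mem j m hm))
      exact add_mem (Submodule.smul_mem _ _ hd)
        (intUnits_smul_mem _ (Submodule.smul_mem _ _ (mem_le hj hm)))
  · intro h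
    refine M.induction (by simp) (fun i m hm => ?_) (fun x y hx hy => ?_)
    · exact mem_smulGE_of_mem_le (lt_add_one i) (h i m (mem_le le_rfl hm)) (M.d_mem i m hm)
    · rw [map_add]
      exact add_mem hx hy

/-! ### The modules `L̂` -/

section Hat

variable (h0 : ∀ a ∈ 𝒜.gr 0, 𝒜.d a = 0) (L : Type u) [AddCommGroup L] [Module 𝒜.A0ᵐᵒᵖ L]

/-- The canonical map from `L ⊗_ℤ A` to its quotient `L̂`, where `l ⊗ a` is encoded as `a ⊗ l`. -/
def hatMk : A ⊗[ℤ] L →+ (hat h0 L).carrier where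
  toFun x := Submodule.Quotient.mk (show (tensorInt 𝒜 L).carrier from x)
  map_zero' := rfl
  map_add' _ _ := rfl

theorem hatMk_surjective : Function.Surjective (hatMk h0 L) :=
  Quot.exists_rep

variable {L}

theorem op_smul_hatMk_tmul (a b : A) (l : L) :
    MulOpposite.op b • hatMk h0 L (a ⊗ₜ l) = hatMk h0 L ((a * b) ⊗ₜ l) :=
  rfl

theorem hatMk_mul_tmul (r : 𝒜.A0) {i : ℤ} {a : A} (ha : a ∈ 𝒜.gr i) (l : L) :
    hatMk h0 L ((𝒜.A0incl r * a) ⊗ₜ l) = hatMk h0 L (a ⊗ₜ (MulOpposite.op r • l)) :=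
  (Submodule.Quotient.eq _).2 (Submodule.subset_span ⟨i, a, r, l, ha, rfl⟩)

variable (L) in
/-- The inclusion `l ↦ l ⊗ 1` of `L` in `L̂`. -/
noncomputable def hatIncl : L →ₗ[𝒜.A0ᵐᵒᵖ] (hat h0 L).carrier where
  toFun l := hatMk h0 L (1 ⊗ₜ l)
  map_add' l l' := by rw [TensorProduct.tmul_add, map_add]
  map_smul' r l := by
    rw [← MulOpposite.op_unop r, ← hatMk_mul_tmul h0 r.unop SetLike.GradedOne.one_mem, mul_one,
      RingHom.id_apply, A0_smul_def, ← one_mul (𝒜.A0incl r.unop), ← op_smul_hatMk_tmul]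
    rfl

theorem op_smul_hatIncl (a : A) (l : L) :
    MulOpposite.op a • hatIncl h0 L l = hatMk h0 L (a ⊗ₜ l) := by
  rw [← one_mul a, ← op_smul_hatMk_tmul, one_mul]
  rfl

theorem hatIncl_mem (l : L) : hatIncl h0 L l ∈ (hat h0 L).gr 0 :=
  ⟨(1 : A) ⊗ₜ[ℤ] l, AddSubgroup.subset_closure ⟨1, SetLike.GradedOne.one_mem, l, rfl⟩, rfl⟩

theorem d_hatIncl (l : L) : (hat h0 L).d (hatIncl h0 L l) = 0 := by
  change hatMk h0 L ((𝒜.d 1) ⊗ₜ l) = 0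
  rw [h0 1 SetLike.GradedOne.one_mem, TensorProduct.zero_tmul, map_zero]

theorem hat_induction {P : (hat h0 L).carrier → Prop} (zero : P 0)
    (add : ∀ x y, P x → P y → P (x + y))
    (smul : ∀ i, ∀ a ∈ 𝒜.gr i, ∀ l, P (MulOpposite.op a • hatIncl h0 L l))
    (x : (hat h0 L).carrier) : P x := by
  obtain ⟨x, rfl⟩ := hatMk_surjective h0 L x
  induction x using TensorProduct.induction_on with
  | zero => rwa [map_zero]
  | add x y hx hy => exact map_add (hatMk h0 L) x y ▸ add _ _ hx hy
  | tmul a l =>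
    rw [← op_smul_hatIncl]
    refine 𝒜.induction (P := fun a => P (MulOpposite.op a • hatIncl h0 L l)) (by simpa using zero)
      (fun i a ha => smul i a ha l) (fun a b ha hb => ?_) a
    rw [MulOpposite.op_add, add_smul]
    exact add _ _ ha hb

theorem hat_gr_induction {i : ℤ} {P : (hat h0 L).carrier → Prop} (zero : P 0)
    (add : ∀ x y, P x → P y → P (x + y)) (neg : ∀ x, P x → P (-x))
    (smul : ∀ a ∈ 𝒜.gr i, ∀ l, P (MulOpposite.op a • hatIncl h0 L l))
    {x : (hat h0 L).carrier} (hx : x ∈ (hat h0 L).gr i) : P x := by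
  suffices h : ∀ y ∈ AddSubgroup.closure {y : A ⊗[ℤ] L | ∃ a ∈ 𝒜.gr i, ∃ l : L, y = a ⊗ₜ l},
      P (hatMk h0 L y) by
    obtain ⟨y, hy, rfl⟩ := hx
    exact h y hy
  intro y hy
  induction hy using AddSubgroup.closure_induction with
  | zero => rwa [map_zero]
  | add x y _ _ hx hy => exact map_add (hatMk h0 L) x y ▸ add _ _ hx hy
  | neg x _ hx => exact map_neg (hatMk h0 L) x ▸ neg _ hx
  | mem x hx =>
    obtain ⟨a, ha, l, rfl⟩ := hx
    exact op_smul_hatIncl h0 a l ▸ smul a ha l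

theorem hasDegree_of_hatIncl_mem {f : (hat h0 L).carrier →ₗ[Aᵐᵒᵖ] N.carrier} {n : ℤ}
    (hf : ∀ l, f (hatIncl h0 L l) ∈ N.gr n) : HasDegree f n := fun i x hx => by
  refine hat_gr_induction h0 (P := fun x => f x ∈ N.gr (i + n)) (by simp) (fun x y hx hy => ?_)
    (fun x hx => ?_) (fun a ha l => ?_) hx
  · rw [map_add]
    exact add_mem hx hy
  · rw [map_neg]
    exact neg_mem hx
  · rw [map_smul, add_comm]
    exact N.smul_mem _ _ _ _ (hf l) ha

theorem hat_gr_eq_bot [𝒜.IsNonneg] (i : ℤ) (hi : i < 0) : (hat h0 L).gr i = ⊥ := by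
  refine eq_bot_iff.2 fun x hx => ?_
  refine hat_gr_induction h0 (P := (· ∈ (⊥ : AddSubgroup _))) (zero_mem _)
    (fun _ _ => add_mem) (fun _ => neg_mem) (fun a ha l => ?_) hx
  rw [DGAlgebra.IsNonneg.gr_eq_bot i hi, Submodule.mem_bot] at ha
  simp [ha]

theorem exists_hatLift (φ : L →ₗ[𝒜.A0ᵐᵒᵖ] N.carrier) :
    ∃ f : (hat h0 L).carrier →ₗ[Aᵐᵒᵖ] N.carrier, ∀ l, f (hatIncl h0 L l) = φ l := by
  let g : A ⊗[ℤ] L →+ N.carrier := TensorProduct.liftAddHom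
    { toFun := fun a => (DistribSMul.toAddMonoidHom N.carrier (MulOpposite.op a)).comp
        φ.toAddMonoidHom
      map_zero' := by ext l; simp
      map_add' := fun a b => by ext l; simp [add_smul] }
    (fun n a l => by
      change MulOpposite.op (n • a) • φ l = MulOpposite.op a • φ (n • l)
      rw [MulOpposite.op_smul, smul_assoc, map_zsmul, smul_comm])
  have hg : ∀ a l, g (a ⊗ₜ[ℤ] l) = MulOpposite.op a • φ l := fun _ _ => rfl
  let G : (tensorInt 𝒜 L).carrier →ₗ[Aᵐᵒᵖ] N.carrier :=
    { g with
      map_smul' := fun r x => by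
        change g (r • (show A ⊗[ℤ] L from x)) = r • g x
        refine TensorProduct.induction_on
          (motive := fun x => g (r • x) = r • g x) x (by simp) (fun a l => ?_)
          (fun x y hx hy => ?_)
        · change g ((a * r.unop) ⊗ₜ[ℤ] l) = r • g (a ⊗ₜ[ℤ] l)
          rw [hg, hg, MulOpposite.op_mul, MulOpposite.op_unop, mul_smul]
        · rw [smul_add, map_add, map_add, hx, hy, smul_add] }
  refine ⟨Submodule.liftQ _ G (Submodule.span_le.2 ?_), fun l => ?_⟩
  · rintro _ ⟨j, a, r, l, _, rfl⟩
    change g ((𝒜.A0incl r * a) ⊗ₜ[ℤ] l - a ⊗ₜ[ℤ] (MulOpposite.op r • l)) = 0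
    rw [map_sub, hg, hg, map_smul, A0_smul_def, MulOpposite.op_mul, mul_smul]
    exact sub_self _
  · change g ((1 : A) ⊗ₜ[ℤ] l) = φ l
    rw [hg, MulOpposite.op_one, one_smul]

theorem exists_sub_hatIncl_mem [𝒜.IsNonneg] (x : (hat h0 L).carrier) :
    ∃ l, x - hatIncl h0 L l ∈ (hat h0 L).smulGE Set.univ 1 := by
  refine hat_induction h0 (P := fun x => ∃ l, x - hatIncl h0 L l ∈ smulGE _ Set.univ 1)
    ⟨0, by simp⟩ ?_ (fun i a ha l => ?_) x
  · rintro x y ⟨l, hl⟩ ⟨l', hl'⟩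
    refine ⟨l + l', ?_⟩
    rw [map_add, add_sub_add_comm]
    exact add_mem hl hl'
  · rcases lt_trichotomy i 0 with hi | rfl | hi
    · rw [DGAlgebra.IsNonneg.gr_eq_bot i hi, Submodule.mem_bot] at ha
      exact ⟨0, by simp [ha]⟩
    · let r : 𝒜.A0 := ⟨a, ha⟩
      have hr : MulOpposite.op a • hatIncl h0 L l = hatIncl h0 L (MulOpposite.op r • l) :=
        ((hatIncl h0 L).map_smul (MulOpposite.op r) l).symm
      exact ⟨MulOpposite.op r • l, by rw [hr, sub_self]; exact zero_mem _⟩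
    · refine ⟨0, ?_⟩
      rw [map_zero, sub_zero]
      exact smul_mem_smulGE (by omega) ha trivial

end Hat

/-! ### Filtered dg modules -/

theorem subquot_iso_iff {F G : DGSub M} : Iso (subquot F G) N ↔
    ∃ ψ : Hom G.toDGModule N, Function.Surjective ψ.toLin ∧
      ∀ x : G.toSubmodule, ψ.toLin x = 0 ↔ x.1 ∈ F.toSubmodule := by
  let π : Hom G.toDGModule (subquot F G) :=
    { toLin := Submodule.mkQ _, map_mem := fun _ _ hm => ⟨_, hm, rfl⟩, map_d := fun _ => rfl }
  have hπ : Function.Surjective π.toLin := Submodule.mkQ_surjective _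
  have hπ0 : ∀ x : G.toSubmodule, π.toLin x = 0 ↔ x.1 ∈ F.toSubmodule :=
    fun x => Submodule.Quotient.mk_eq_zero _
  constructor
  · rintro ⟨φ, hφ⟩
    refine ⟨φ.comp π, hφ.bijective.2.comp hπ, fun x => ?_⟩
    exact (map_eq_zero_iff φ.toLin hφ.bijective.1).trans (hπ0 x)
  · rintro ⟨ψ, hψ, hψ0⟩
    let φ : Hom (subquot F G) N :=
      { toLin := Submodule.liftQ _ ψ.toLin fun x hx => (hψ0 x).2 hx
        map_mem := by
          rintro i _ ⟨x, hx, rfl⟩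
          exact ψ.map_mem i x hx
        map_d := hπ.forall.2 ψ.map_d }
    refine ⟨φ, φ.isIso_of_bijective ⟨(injective_iff_map_eq_zero φ.toLin).2 ?_, fun z => ?_⟩⟩
    · exact hπ.forall.2 fun x hx => (hπ0 x).2 ((hψ0 x).1 hx)
    · obtain ⟨x, rfl⟩ := hψ z
      exact ⟨π.toLin x, rfl⟩

section Filt

variable {h0 : ∀ a ∈ 𝒜.gr 0, 𝒜.d a = 0}

theorem mem_of_subquot_iso {F G : DGSub M} {l : ℤ} {L : Type u} [AddCommGroup L]
    [Module 𝒜.A0ᵐᵒᵖ L] (h : Iso (subquot F G) (shift l (hat h0 L))) {Q : AddSubgroup M.carrier}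
    (hF : ∀ x ∈ F.toSubmodule, x ∈ Q)
    (hQ : ∀ x ∈ M.gr (-l), M.d x ∈ F.toSubmodule → ∀ j, ∀ a ∈ 𝒜.gr j, MulOpposite.op a • x ∈ Q)
    {y : M.carrier} (hy : y ∈ G.toSubmodule) : y ∈ Q := by
  obtain ⟨ψ, hψ, hψ0⟩ := subquot_iso_iff.1 h
  have hgen : ∀ e : L, ∃ x : G.toSubmodule, ψ.toLin x = hatIncl h0 L e ∧ x.1 ∈ M.gr (-l) ∧
      M.d x.1 ∈ F.toSubmodule := fun e => by
    obtain ⟨y, hy⟩ := hψ (hatIncl h0 L e)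
    let x := G.toDGModule.proj (-l) y
    have hx : ψ.toLin x = hatIncl h0 L e := by
      rw [ψ.map_proj, hy]
      refine proj_same _ ?_
      change _ ∈ (hat h0 L).gr (-l + l)
      rw [neg_add_cancel]
      exact hatIncl_mem h0 e
    refine ⟨x, hx, G.toDGModule.proj_mem (-l) y, (hψ0 (G.toDGModule.d x)).1 ?_⟩
    rw [ψ.map_d, hx]
    change l.negOnePow • (hat h0 L).d (hatIncl h0 L e) = 0
    rw [d_hatIncl, smul_zero]
  have hlift : ∀ z : (hat h0 L).carrier, ∃ x : G.toSubmodule, ψ.toLin x = z ∧ x.1 ∈ Q := by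
    refine hat_induction h0 ⟨0, map_zero _, zero_mem _⟩ ?_ fun j a ha e => ?_
    · rintro z z' ⟨x, hx, hxQ⟩ ⟨x', hx', hxQ'⟩
      exact ⟨x + x', (map_add ψ.toLin x x').trans (congrArg₂ _ hx hx'), add_mem hxQ hxQ'⟩
    · obtain ⟨x, hx, hxl, hxd⟩ := hgen e
      exact ⟨MulOpposite.op a • x, (map_smul ψ.toLin _ x).trans (congrArg _ hx),
        hQ x.1 hxl hxd j a ha⟩
  obtain ⟨x, hx, hxQ⟩ := hlift (ψ.toLin ⟨y, hy⟩)
  have hyx : y - x.1 ∈ F.toSubmodule :=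
    (hψ0 (⟨y, hy⟩ - x)).1 ((map_sub ψ.toLin _ _).trans (sub_eq_zero.2 hx.symm))
  simpa using add_mem (hF _ hyx) hxQ

variable [𝒜.IsNonneg]

theorem IsFilt.isBoundedBelow (h : M.IsFilt h0) : M.IsBoundedBelow := by
  obtain ⟨n, F, l, hbot, htop, -, hF⟩ := h
  obtain ⟨c, hc⟩ := (Set.finite_range fun i => -l i).bddBelow
  refine ⟨c, fun s hs => eq_bot_iff.2 fun x hx => ?_⟩
  have key : ∀ i, ∀ x ∈ (F i).toSubmodule, x ∈ (M.proj s).ker := by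
    intro i
    induction i using Fin.induction with
    | zero =>
      intro x hx
      rw [hbot, Submodule.mem_bot] at hx
      exact hx ▸ zero_mem _
    | succ i ih =>
      obtain ⟨-, L, _, _, -, hiso⟩ := hF i
      refine fun y hy => mem_of_subquot_iso hiso ih (fun x hx _ => ?_) hy
      refine fun j a ha => AddMonoidHom.mem_ker.2 ?_
      have hci : c ≤ -l i := hc ⟨i, rfl⟩
      rcases lt_or_ge j 0 with hj | hj
      · rw [DGAlgebra.IsNonneg.gr_eq_bot j hj, Submodule.mem_bot] at ha
        simp [ha]
      · rw [M.proj_smul ha, M.proj_ne (by omega) hx, smul_zero]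
  rw [AddSubgroup.mem_bot, ← M.proj_same hx]
  exact key (Fin.last n) x (htop ▸ Submodule.mem_top)

theorem IsFilt.isMinimal (h : M.IsFilt h0) : M.IsMinimal := by
  obtain ⟨n, F, l, hbot, htop, hl, hF⟩ := h
  have hle : ∀ (i : Fin (n + 1)) (c : ℤ), (∀ j : Fin n, j.castSucc < i → -l j ≤ c) →
      ∀ x ∈ (F i).toSubmodule, x ∈ (M.le c).toAddSubgroup := by
    intro i
    induction i using Fin.induction with
    | zero =>
      intro c _ x hx
      rw [hbot, Submodule.mem_bot] at hx
      exact hx ▸ zero_mem _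
    | succ i ih =>
      intro c hc y hy
      obtain ⟨-, L, _, _, -, hiso⟩ := hF i
      refine mem_of_subquot_iso hiso (ih c fun j hj => hc j (hj.trans Fin.castSucc_lt_succ))
        (fun x hx _ j a _ => ?_) hy
      exact Submodule.smul_mem (M.le c) _ (mem_le (hc i Fin.castSucc_lt_succ) hx)
  have hmin : ∀ i, ∀ x ∈ (F i).toSubmodule,
      x ∈ (M.smulGE Set.univ 1).toAddSubgroup.comap M.d := by
    intro i
    induction i using Fin.induction with
    | zero =>
      intro x hx
      rw [hbot, Submodule.mem_bot] at hx
      exact hx ▸ zero_mem _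
    | succ i ih =>
      obtain ⟨-, L, _, _, -, hiso⟩ := hF i
      refine fun y hy => mem_of_subquot_iso hiso ih (fun x hx hdx j a _ => ?_) hy
      have hd : M.d x ∈ M.smulGE Set.univ 1 := mem_smulGE_of_mem_le (lt_add_one _)
        (hle i.castSucc (-l i) (fun j hj => neg_le_neg (hl (Fin.castSucc_lt_castSucc_iff.1 hj).le))
          _ hdx) (M.d_mem _ _ hx)
      rw [AddSubgroup.mem_comap, M.leibniz _ _ _ hx]
      exact add_mem (Submodule.smul_mem _ _ hd)
        (intUnits_smul_mem _ (op_d_smul_mem_smulGE a trivial))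
  exact fun x => hmin (Fin.last n) x (htop ▸ Submodule.mem_top)

end Filt

/-! ### Minimal cells are filtered -/

/-- The projection of a dg module onto its quotient by a dg submodule. -/
def quotMk (S : DGSub M) : Hom M (M.quot S) where
  toLin := S.toSubmodule.mkQ
  map_mem _ m hm := ⟨m, hm, rfl⟩
  map_d _ := rfl

theorem quotMk_surjective (S : DGSub M) : Function.Surjective (quotMk S).toLin :=
  S.toSubmodule.mkQ_surjective

theorem quotMk_eq_zero {S : DGSub M} {x : M.carrier} :
    (quotMk S).toLin x = 0 ↔ x ∈ S.toSubmodule :=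
  Submodule.Quotient.mk_eq_zero S.toSubmodule

/-- The inverse image of a dg submodule under a morphism of dg modules. -/
def DGSub.comap (f : Hom M N) (S : DGSub N) : DGSub M where
  toSubmodule := S.toSubmodule.comap f.toLin
  proj_mem i m hm := by
    rw [Submodule.mem_comap] at hm ⊢
    exact f.map_proj i m ▸ S.proj_mem i _ hm
  d_mem m hm := by
    rw [Submodule.mem_comap] at hm ⊢
    exact f.map_d m ▸ S.d_mem _ hm

/-- The zero dg submodule. -/
def DGSub.bot (M : DGModule 𝒜) : DGSub M where
  toSubmodule := ⊥
  proj_mem i m hm := by rw [(Submodule.mem_bot _).1 hm, map_zero]; exact zero_mem _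
  d_mem m hm := by rw [(Submodule.mem_bot _).1 hm, map_zero]; exact zero_mem _

theorem subquot_bot_iso {G : DGSub M} (j : Hom N M) (hj : Function.Injective j.toLin)
    (hG : G.toSubmodule = LinearMap.range j.toLin) : Iso (subquot (DGSub.bot M) G) N := by
  let j' : Hom N G.toDGModule :=
    { toLin := j.toLin.codRestrict _ fun y => hG ▸ ⟨y, rfl⟩
      map_mem := j.map_mem
      map_d := fun m => Subtype.ext (j.map_d m) }
  have hj' : Function.Bijective j'.toLin := by
    refine ⟨fun y z h => hj (congrArg Subtype.val h), fun ⟨x, hx⟩ => ?_⟩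
    obtain ⟨y, rfl⟩ := hG ▸ hx
    exact ⟨y, rfl⟩
  obtain ⟨g, hgj, hjg⟩ := j'.isIso_of_bijective hj'
  have hg : g.IsIso := ⟨j', hjg, hgj⟩
  refine subquot_iso_iff.2 ⟨g, hg.bijective.2, fun x => ?_⟩
  exact (map_eq_zero_iff g.toLin hg.bijective.1).trans (Subtype.ext_iff.trans Iff.rfl)

theorem subquot_comap_iso {F G : DGSub N} (h : Iso (subquot F G) P) (q : Hom M N)
    (hq : Function.Surjective q.toLin) : Iso (subquot (F.comap q) (G.comap q)) P := by
  obtain ⟨ψ, hψ, hψ0⟩ := subquot_iso_iff.1 h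
  let q' : Hom (G.comap q).toDGModule G.toDGModule :=
    { toLin := q.toLin.restrict fun _ hx => hx
      map_mem := fun j m hm => q.map_mem j m.1 hm
      map_d := fun m => Subtype.ext (q.map_d m.1) }
  refine subquot_iso_iff.2 ⟨ψ.comp q', hψ.comp fun ⟨z, hz⟩ => ?_, fun x => hψ0 (q'.toLin x)⟩
  obtain ⟨x, rfl⟩ := hq z
  exact ⟨⟨x, hz⟩, rfl⟩

/-- The condition `IsFilt` with all simple constituents generated in degrees at least `a`. -/
def IsFiltGE (h0 : ∀ a ∈ 𝒜.gr 0, 𝒜.d a = 0) (M : DGModule 𝒜) (a : ℤ) : Prop :=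
  ∃ (n : ℕ) (F : Fin (n + 1) → DGSub M) (l : Fin n → ℤ),
    (F 0).toSubmodule = ⊥ ∧ (F (Fin.last n)).toSubmodule = ⊤ ∧ Antitone l ∧ (∀ i, l i ≤ -a) ∧
    ∀ i : Fin n, (F i.castSucc).toSubmodule ≤ (F i.succ).toSubmodule ∧
      ∃ (L : Type u) (_ : AddCommGroup L) (_ : Module 𝒜.A0ᵐᵒᵖ L),
        IsSimpleModule 𝒜.A0ᵐᵒᵖ L ∧
        Iso (subquot (F i.castSucc) (F i.succ)) (DGModule.shift (l i) (hat h0 L))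

namespace IsFiltGE

variable {h0 : ∀ a ∈ 𝒜.gr 0, 𝒜.d a = 0}

theorem isFilt {a : ℤ} (h : M.IsFiltGE h0 a) : M.IsFilt h0 := by
  obtain ⟨n, F, l, hbot, htop, hl, -, hF⟩ := h
  exact ⟨n, F, l, hbot, htop, hl, hF⟩

theorem mono {a b : ℤ} (hab : a ≤ b) (h : M.IsFiltGE h0 b) : M.IsFiltGE h0 a := by
  obtain ⟨n, F, l, hbot, htop, hl, hlb, hF⟩ := h
  exact ⟨n, F, l, hbot, htop, hl, fun i => (hlb i).trans (neg_le_neg hab), hF⟩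

theorem of_subsingleton [Subsingleton M.carrier] (a : ℤ) : M.IsFiltGE h0 a :=
  ⟨0, fun _ => DGSub.bot M, Fin.elim0, rfl, Subsingleton.elim _ _, fun i => i.elim0,
    fun i => i.elim0, fun i => i.elim0⟩

theorem of_quot {a : ℤ} {L : Type u} [AddCommGroup L] [Module 𝒜.A0ᵐᵒᵖ L]
    [IsSimpleModule 𝒜.A0ᵐᵒᵖ L] (j : Hom (DGModule.shift (-a) (hat h0 L)) M)
    (hj : Function.Injective j.toLin) (h : (M.quot j.range).IsFiltGE h0 a) :
    M.IsFiltGE h0 a := by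
  obtain ⟨n, F, l, hbot, htop, hl, hla, hF⟩ := h
  let q := quotMk j.range
  refine ⟨n + 1, Fin.cons (DGSub.bot M) fun i => (F i).comap q, Fin.cons (-a) l, rfl, ?_, ?_, ?_,
    ?_⟩
  · rw [← Fin.succ_last, Fin.cons_succ]
    exact congrArg (Submodule.comap q.toLin) htop
  · intro i j hij
    cases i using Fin.cases <;> cases j using Fin.cases
    · rfl
    · exact hla _
    · exact absurd hij (Fin.succ_pos _).not_ge
    · exact hl (Fin.succ_le_succ_iff.1 hij)
  · exact Fin.cases le_rfl hla
  · refine Fin.cases ?_ fun i => ?_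
    · refine ⟨bot_le, L, _, _, inferInstance, subquot_bot_iso j hj ?_⟩
      change (F 0).toSubmodule.comap q.toLin = _
      rw [hbot]
      exact Submodule.ker_mkQ _
    · obtain ⟨hle, L', i1, i2, hL', hiso⟩ := hF i
      exact ⟨Submodule.comap_mono hle, L', i1, i2, hL',
        subquot_comap_iso hiso q (quotMk_surjective _)⟩

end IsFiltGE

/-- The cycles of degree `a`, as an `A^0`-module. -/
def cycles (h0 : ∀ a ∈ 𝒜.gr 0, 𝒜.d a = 0) (M : DGModule 𝒜) (a : ℤ) :
    Submodule 𝒜.A0ᵐᵒᵖ M.carrier where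
  carrier := {x | x ∈ M.gr a ∧ M.d x = 0}
  add_mem' hx hy := ⟨add_mem hx.1 hy.1, by rw [map_add, hx.2, hy.2, add_zero]⟩
  zero_mem' := ⟨zero_mem _, map_zero _⟩
  smul_mem' r x hx := by
    have hr := 𝒜.A0incl_mem r.unop
    refine ⟨add_zero a ▸ M.smul_mem a 0 x _ hx.1 hr, ?_⟩
    rw [A0_smul_def, M.leibniz a x _ hx.1, hx.2, h0 _ hr]
    simp

theorem exists_hatHom (h0 : ∀ a ∈ 𝒜.gr 0, 𝒜.d a = 0) {L : Type u} [AddCommGroup L]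
    [Module 𝒜.A0ᵐᵒᵖ L] {a : ℤ} (φ : L →ₗ[𝒜.A0ᵐᵒᵖ] M.carrier) (hφ : ∀ l, φ l ∈ cycles h0 M a) :
    ∃ j : Hom (shift (-a) (hat h0 L)) M, ∀ l, j.toLin (hatIncl h0 L l) = φ l := by
  obtain ⟨j, hj⟩ := exists_hatLift h0 φ
  have hdeg : HasDegree j a := hasDegree_of_hatIncl_mem h0 fun l => hj l ▸ (hφ l).1
  have hd : ∀ x, j ((hat h0 L).d x) = a.negOnePow • M.d (j x) := by
    refine hat_induction h0 (by simp) (fun x y hx hy => ?_) fun i c _ l => ?_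
    · simp only [map_add, smul_add, hx, hy]
    · rw [map_smul j (MulOpposite.op c), (hat h0 L).leibniz 0 _ c (hatIncl_mem h0 l), d_hatIncl,
        hj, M.leibniz a _ c (hφ l).1, (hφ l).2]
      simp [smul_smul, hj]
  have hd' : ∀ x : (hat h0 L).carrier, j ((-a).negOnePow • (hat h0 L).d x) = M.d (j x) :=
    fun x => by
      rw [Int.negOnePow_neg, Units.smul_def, map_zsmul, hd, ← Units.smul_def, smul_smul]
      simp
  exact ⟨⟨j, fun i m hm => neg_add_cancel_right i a ▸ hdeg _ m hm, hd'⟩, hj⟩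

section Nonneg

variable [𝒜.IsNonneg]

theorem IsNilSub.proj_eq_zero {a : ℤ} (ha : ∀ i < a, M.gr i = ⊥)
    (hd : ∀ x ∈ M.gr a, M.d x = 0 → x = 0) {Y : Submodule 𝒜.A0ᵐᵒᵖ M.bar.carrier}
    (hY : IsNilSub M Y) : ∀ x, M.barMk x ∈ Y → M.proj a x = 0 := by
  induction hY with
  | bot => exact fun x hx => proj_eq_zero_of_mem_smulGE ha (lt_add_one a) (barMk_eq_zero.1 hx)
  | @step Y Z _ hZ ih =>
    refine fun x hx => hd _ (M.proj_mem a x) ?_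
    obtain ⟨u, hu, v, hv, huv⟩ := Submodule.mem_sup.1 (hZ x hx)
    rw [M.d_proj, ← huv, map_add, proj_eq_zero_of_mem_smulGE ha (by omega) hv, add_zero]
    refine smulGE_induction (P := fun u => M.proj (a + 1) u = 0) (map_zero _)
      (fun x y hx hy => by rw [map_add, hx, hy, add_zero]) (fun j hj c hc y hy => ?_) hu
    rw [M.proj_smul hc]
    rcases hj.eq_or_lt with rfl | hj
    · rw [add_sub_cancel_right, ih y hy, smul_zero]
    · rw [proj_eq_zero_of_lt ha (by omega), smul_zero]

theorem IsMinimalCell.cycles_ne_bot (h0 : ∀ a ∈ 𝒜.gr 0, 𝒜.d a = 0) (hM : IsMinimalCell M) {a : ℤ}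
    (ha : ∀ i < a, M.gr i = ⊥) (hne : M.gr a ≠ ⊥) : cycles h0 M a ≠ ⊥ := by
  refine fun hbot => hne (eq_bot_iff.2 fun x hx => ?_)
  rw [AddSubgroup.mem_bot, ← M.proj_same hx]
  refine hM.isNilSub_top.proj_eq_zero ha (fun x hx hdx => ?_) x trivial
  have hxC : x ∈ cycles h0 M a := ⟨hx, hdx⟩
  rwa [hbot, Submodule.mem_bot] at hxC

theorem eq_zero_of_mem_gr_of_mem_smulGE {a : ℤ} (ha : ∀ i < a, M.gr i = ⊥) {x : M.carrier}
    (hx : x ∈ M.gr a) (hx' : x ∈ M.smulGE Set.univ 1) : x = 0 := by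
  rw [← M.proj_same hx, proj_eq_zero_of_mem_smulGE ha (lt_add_one a) hx']

theorem barMap_injective_of_hatIncl (h0 : ∀ a ∈ 𝒜.gr 0, 𝒜.d a = 0) {L : Type u} [AddCommGroup L]
    [Module 𝒜.A0ᵐᵒᵖ L] {n : ℤ}
    {f : (shift n (hat h0 L)).carrier →ₗ[Aᵐᵒᵖ] M.carrier}
    (hf : ∀ l, f (hatIncl h0 L l) ∈ M.smulGE Set.univ 1 → l = 0) :
    Function.Injective (barMap f) := by
  have hfx : ∀ x : (hat h0 L).carrier, f x ∈ M.smulGE Set.univ 1 →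
      x ∈ (hat h0 L).smulGE Set.univ 1 := by
    intro x hx
    obtain ⟨l, hl⟩ := exists_sub_hatIncl_mem h0 x
    have hsub : f x - f (hatIncl h0 L l) ∈ M.smulGE Set.univ 1 :=
      map_sub f x _ ▸ map_mem_smulGE_univ (M := shift n (hat h0 L)) f hl
    have hfl : f (hatIncl h0 L l) ∈ M.smulGE Set.univ 1 :=
      sub_sub_cancel (f x) (f (hatIncl h0 L l)) ▸ sub_mem hx hsub
    rwa [hf l hfl, map_zero, sub_zero] at hl
  refine (injective_iff_map_eq_zero _).2 fun z hz => ?_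
  obtain ⟨x, rfl⟩ := (shift n (hat h0 L)).barMk_surjective z
  exact barMk_eq_zero.2 (hfx x (barMk_eq_zero.1 hz))

theorem exists_leftInverse_of_barMap_injective [IsSemisimpleRing 𝒜.A0]
    [Module.Projective Aᵐᵒᵖ N.carrier] (hM : M.IsBoundedBelow) (j : Hom M N)
    (hj : Function.Injective (barMap j.toLin)) :
    ∃ g : N.carrier →ₗ[Aᵐᵒᵖ] M.carrier, g ∘ₗ j.toLin = LinearMap.id := by
  obtain ⟨f, hfdeg, hf⟩ := exists_hasDegree_quasiInverse (barMap j.toLin) (n := 0) (by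
    rintro i _ ⟨x, hx, rfl⟩
    exact (add_zero i).symm ▸ (⟨j.toLin x, j.map_mem i x hx, rfl⟩ : _ ∈ N.bar.gr i))
  have hfj : Function.Bijective (f ∘ₗ j.toLin) := by
    refine HasDegree.bijective_of_sub_mem hM (hfdeg.comp j.hasDegree) fun x => ?_
    rw [← barMk_eq_zero, map_sub, sub_eq_zero]
    exact hj (LinearMap.congr_fun hf (M.barMk x))
  let e := LinearEquiv.ofBijective _ hfj
  exact ⟨e.symm.toLinearMap ∘ₗ f, LinearMap.ext e.symm_apply_apply⟩

theorem IsMinimalCell.quot_range (hM : IsMinimalCell M) (j : Hom N M)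
    {g : M.carrier →ₗ[Aᵐᵒᵖ] N.carrier} (hg : g ∘ₗ j.toLin = LinearMap.id) :
    IsMinimalCell (M.quot j.range) := by
  have hgj : ∀ y, g (j.toLin y) = y := LinearMap.congr_fun hg
  let s : (M.quot j.range).carrier →ₗ[Aᵐᵒᵖ] M.carrier :=
    Submodule.liftQ _ (LinearMap.id - j.toLin ∘ₗ g) (by
      rintro _ ⟨y, rfl⟩
      simp [hgj])
  refine hM.of_split (quotMk j.range) (s := s) (LinearMap.ext fun z => ?_)
  obtain ⟨x, rfl⟩ := quotMk_surjective _ z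
  change (quotMk j.range).toLin (x - j.toLin (g x)) = (quotMk j.range).toLin x
  have hgx : (quotMk j.range).toLin (j.toLin (g x)) = 0 := quotMk_eq_zero.2 ⟨g x, rfl⟩
  rw [map_sub, hgx, sub_zero]

end Nonneg

theorem barLength_add_one_le {q : Hom M N} (hq : Function.Surjective q.toLin) {x : M.carrier}
    (hx : x ∉ M.smulGE Set.univ 1) (hqx : q.toLin x = 0) : N.barLength + 1 ≤ M.barLength := by
  let f := barMap q.toLin
  have hf : Function.Surjective f := fun z => by
    obtain ⟨y, rfl⟩ := N.barMk_surjective z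
    obtain ⟨x, rfl⟩ := hq y
    exact ⟨M.barMk x, rfl⟩
  have hker : Nontrivial (LinearMap.ker f) :=
    ⟨⟨M.barMk x, LinearMap.mem_ker.2 ((congrArg N.barMk hqx).trans (map_zero _))⟩, 0,
      fun h => hx (barMk_eq_zero.1 (congrArg Subtype.val h))⟩
  calc N.barLength + 1 ≤ N.barLength + Module.length 𝒜.A0ᵐᵒᵖ (LinearMap.ker f) := by
        gcongr
        exact Order.one_le_iff_pos.2 Module.length_pos
    _ = M.barLength := by
        rw [add_comm]
        exact (Module.length_eq_add_of_exact (LinearMap.ker f).subtype f Subtype.val_injective hf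
          (LinearMap.exact_subtype_ker_map f)).symm

section IsFilt

variable [𝒜.IsNonneg] [IsSemisimpleRing 𝒜.A0]

theorem IsMinimalCell.exists_simple_cycles (h0 : ∀ a ∈ 𝒜.gr 0, 𝒜.d a = 0) (hM : IsMinimalCell M)
    {a : ℤ} (ha : ∀ i < a, M.gr i = ⊥) (hne : M.gr a ≠ ⊥) :
    ∃ (L : Type u) (_ : AddCommGroup L) (_ : Module 𝒜.A0ᵐᵒᵖ L) (φ : L →ₗ[𝒜.A0ᵐᵒᵖ] M.carrier),
      IsSimpleModule 𝒜.A0ᵐᵒᵖ L ∧ Function.Injective φ ∧ ∀ l, φ l ∈ cycles h0 M a := by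
  have := Submodule.nontrivial_iff_ne_bot.2 (hM.cycles_ne_bot h0 ha hne)
  obtain ⟨L, hL⟩ := IsSemisimpleModule.exists_simple_submodule 𝒜.A0ᵐᵒᵖ (cycles h0 M a)
  let φ : L →ₗ[𝒜.A0ᵐᵒᵖ] M.carrier := (cycles h0 M a).subtype ∘ₗ L.subtype
  exact ⟨L, _, _, φ, hL,
    Subtype.val_injective.comp Subtype.val_injective, fun l => l.1.2⟩

theorem IsMinimalCell.exists_quot_range (h0 : ∀ a ∈ 𝒜.gr 0, 𝒜.d a = 0) (hM : IsMinimalCell M)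
    {a : ℤ} (ha : ∀ i < a, M.gr i = ⊥) (hne : M.gr a ≠ ⊥) :
    ∃ (L : Type u) (_ : AddCommGroup L) (_ : Module 𝒜.A0ᵐᵒᵖ L)
      (j : Hom (DGModule.shift (-a) (hat h0 L)) M),
      IsSimpleModule 𝒜.A0ᵐᵒᵖ L ∧ Function.Injective j.toLin ∧
      IsMinimalCell (M.quot j.range) ∧ (M.quot j.range).barLength + 1 ≤ M.barLength := by
  have := hM.projective
  obtain ⟨L, _, _, φ, hL, hφinj, hφ⟩ := hM.exists_simple_cycles h0 ha hne
  have hφ0 : ∀ l, φ l ∈ M.smulGE Set.univ 1 → l = 0 := fun l hl =>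
    (map_eq_zero_iff φ hφinj).1 (eq_zero_of_mem_gr_of_mem_smulGE ha (hφ l).1 hl)
  obtain ⟨j, hj⟩ := exists_hatHom h0 φ hφ
  obtain ⟨g, hg⟩ := exists_leftInverse_of_barMap_injective
    ⟨a, fun i hi => hat_gr_eq_bot h0 (i + -a) (by omega)⟩ j
    (barMap_injective_of_hatIncl h0 fun l hl => hφ0 l (hj l ▸ hl))
  refine ⟨L, _, _, j, hL,
    Function.LeftInverse.injective (LinearMap.congr_fun hg), hM.quot_range j hg, ?_⟩
  have := IsSimpleModule.nontrivial 𝒜.A0ᵐᵒᵖ L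
  obtain ⟨l, hl⟩ := exists_ne (0 : L)
  exact barLength_add_one_le (quotMk_surjective _) (fun h => hl (hφ0 l h))
    (quotMk_eq_zero.2 ⟨_, hj l⟩)

theorem IsMinimalCell.isFiltGE (h0 : ∀ a ∈ 𝒜.gr 0, 𝒜.d a = 0) (hM : IsMinimalCell M)
    (hlen : M.barLength ≠ ⊤) {a : ℤ} (ha : ∀ i < a, M.gr i = ⊥) : M.IsFiltGE h0 a := by
  obtain ⟨n, hn⟩ := ENat.ne_top_iff_exists.1 hlen
  induction n using Nat.strong_induction_on generalizing M a with | _ n ih => ?_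
  by_cases hz : ∀ i, M.gr i = ⊥
  · have : Subsingleton M.carrier := subsingleton_of_forall_eq 0 fun x =>
      eq_zero_of_forall_proj_eq_zero fun i => by
        simpa [hz i] using M.proj_mem i x
    exact .of_subsingleton a
  push Not at hz
  obtain ⟨b, hb, hmin⟩ := Int.exists_least_of_bdd (P := fun i => M.gr i ≠ ⊥)
    ⟨a, fun i hi => not_lt.1 fun h => hi (ha i h)⟩ hz
  have hbelow : ∀ i < b, M.gr i = ⊥ := fun i hi => not_not.1 fun h => (hmin i h).not_gt hi
  obtain ⟨L, _, _, j, _, hj, hQ, hlt⟩ := hM.exists_quot_range h0 hbelow hb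
  rw [← hn] at hlt
  obtain ⟨m, hm⟩ := ENat.ne_top_iff_exists.1 (ne_top_of_le_ne_top (ENat.natCast_ne_top n)
    (le_self_add.trans hlt))
  rw [← hm] at hlt
  refine (IsFiltGE.of_quot j hj (ih m ?_ hQ (hm ▸ ENat.natCast_ne_top m) (fun i hi => ?_) hm)).mono
    (not_lt.1 fun h => hb (ha b h))
  · exact_mod_cast hlt
  · exact (congrArg (AddSubgroup.map _) (hbelow i hi)).trans (AddSubgroup.map_bot _)

theorem IsMinimalCell.isFilt (h0 : ∀ a ∈ 𝒜.gr 0, 𝒜.d a = 0) (hM : IsMinimalCell M) :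
    M.IsFilt h0 := by
  have := hM.finite
  obtain ⟨a, ha⟩ := isBoundedBelow_of_finite (M := M)
  exact (hM.isFiltGE h0 Module.length_ne_top ha).isFilt

end IsFilt

/-! ### Lengths -/

theorem IsHomotopyRetract.barHLength_le (h : IsHomotopyRetract M N) :
    M.barHLength ≤ N.barHLength := by
  obtain ⟨i, p, h⟩ := h
  obtain ⟨s, hs⟩ : ∃ s, barMap p.toLin ∘ₗ barMap i.toLin - LinearMap.id =
      M.barD ∘ₗ s + s ∘ₗ M.barD := by
    rw [← barMap_comp, ← barMap_id]
    exact h.exists_barMap_sub_eq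
  have hi : ∀ x, barMap i.toLin (M.barD x) = N.barD (barMap i.toLin x) :=
    LinearMap.congr_fun i.barMap_comp_barD
  have hp : ∀ y, barMap p.toLin (N.barD y) = M.barD (barMap p.toLin y) :=
    LinearMap.congr_fun p.barMap_comp_barD
  let κ : LinearMap.ker M.barD →ₗ[𝒜.A0ᵐᵒᵖ] LinearMap.ker N.barD :=
    (barMap i.toLin).restrict fun x hx => by
      rw [LinearMap.mem_ker, ← hi, LinearMap.mem_ker.1 hx, map_zero]
  let f : M.barH →ₗ[𝒜.A0ᵐᵒᵖ] N.barH := Submodule.mapQ _ _ κ (by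
    rintro x ⟨y, hy⟩
    exact ⟨barMap i.toLin y, (hi y).symm.trans (congrArg (barMap i.toLin) hy)⟩)
  refine Module.length_le_of_injective f ((injective_iff_map_eq_zero f).2 fun z hz => ?_)
  obtain ⟨⟨x, hx⟩, rfl⟩ := Submodule.mkQ_surjective _ z
  obtain ⟨y, hy⟩ : ∃ y, N.barD y = barMap i.toLin x := (Submodule.Quotient.mk_eq_zero _).1 hz
  refine (Submodule.Quotient.mk_eq_zero _).2 ⟨barMap p.toLin y - s x, ?_⟩
  have hsx : barMap p.toLin (barMap i.toLin x) - x = M.barD (s x) + s (M.barD x) :=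
    LinearMap.congr_fun hs x
  rw [LinearMap.mem_ker.1 hx, map_zero, add_zero, sub_eq_iff_eq_add'] at hsx
  change M.barD _ = x
  rw [map_sub, ← hp, hy, hsx, add_sub_cancel_right]

theorem HotIso.barHLength_eq (h : HotIso M N) : M.barHLength = N.barHLength :=
  le_antisymm h.isHomotopyRetract.barHLength_le h.symm.isHomotopyRetract.barHLength_le

theorem barHLength_le_length_ker (M : DGModule 𝒜) :
    M.barHLength ≤ Module.length 𝒜.A0ᵐᵒᵖ (LinearMap.ker M.barD) :=
  Module.length_le_of_surjective _ (Submodule.mkQ_surjective _)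

theorem barHLength_le_barLength (M : DGModule 𝒜) : M.barHLength ≤ M.barLength :=
  M.barHLength_le_length_ker.trans
    (Module.length_le_of_injective (LinearMap.ker M.barD).subtype Subtype.val_injective)

theorem IsMinimal.barLength_eq_barHLength (h : M.IsMinimal) : M.barLength = M.barHLength := by
  have hd : ∀ x, M.barD x = 0 := LinearMap.congr_fun (isMinimal_iff_barD_eq_zero.1 h)
  refine le_antisymm ?_ M.barHLength_le_barLength
  let f : M.bar.carrier →ₗ[𝒜.A0ᵐᵒᵖ] M.barH :=
    Submodule.mkQ _ ∘ₗ LinearMap.codRestrict (LinearMap.ker M.barD) LinearMap.id hd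
  refine Module.length_le_of_injective f ((injective_iff_map_eq_zero f).2 fun x hx => ?_)
  obtain ⟨y, hy⟩ := (Submodule.Quotient.mk_eq_zero _).1 hx
  exact hy.symm.trans (hd y)

theorem isMinimal_of_barLength_eq_barHLength (hfin : M.barHLength ≠ ⊤)
    (h : M.barLength = M.barHLength) : M.IsMinimal := by
  have hadd : M.barLength = Module.length 𝒜.A0ᵐᵒᵖ (LinearMap.ker M.barD) +
      Module.length 𝒜.A0ᵐᵒᵖ (LinearMap.range M.barD) :=
    Module.length_eq_add_of_exact (LinearMap.ker M.barD).subtype M.barD.rangeRestrict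
      Subtype.val_injective M.barD.surjective_rangeRestrict (LinearMap.exact_iff.2 (by
        rw [LinearMap.ker_rangeRestrict, Submodule.range_subtype]))
  have hrange : Module.length 𝒜.A0ᵐᵒᵖ (LinearMap.range M.barD) ≤ 0 := by
    refine (ENat.add_le_add_iff_left hfin).1 ?_
    calc M.barHLength + Module.length 𝒜.A0ᵐᵒᵖ (LinearMap.range M.barD) ≤ M.barLength := by
          rw [hadd]
          gcongr
          exact M.barHLength_le_length_ker
      _ = M.barHLength + 0 := by rw [h, add_zero]
  have := Module.length_eq_zero_iff.1 (nonpos_iff_eq_zero.1 hrange)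
  rw [isMinimal_iff_barD_eq_zero, ← LinearMap.range_eq_bot]
  exact Submodule.subsingleton_iff_eq_bot.1 this

/-! ### Perfect dg modules -/

namespace IsPerfect

variable [𝒜.IsNonneg] [IsSemisimpleRing 𝒜.A0] {h0 : ∀ a ∈ 𝒜.gr 0, 𝒜.d a = 0}

theorem isFilt_iff_isHomotopicallyMinimal (hM : M.IsPerfect) :
    M.IsFilt h0 ↔ M.IsHomotopicallyMinimal := by
  refine ⟨fun h => h.isMinimal.isHomotopicallyMinimal h.isBoundedBelow, fun h => ?_⟩
  obtain ⟨N, hN, hMN⟩ := hM.exists_hotIso h0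
  exact (h.isMinimalCell hN hMN).isFilt h0

theorem exists_hotIso_barLength_eq (h0 : ∀ a ∈ 𝒜.gr 0, 𝒜.d a = 0) (hM : M.IsPerfect) :
    M.barHLength ≠ ⊤ ∧ ∃ N, HotIso M N ∧ N.barLength = M.barHLength := by
  obtain ⟨N, hN, hMN⟩ := hM.exists_hotIso h0
  have := hN.finite
  have hlen : N.barLength = M.barHLength :=
    hN.isMinimal.barLength_eq_barHLength.trans hMN.barHLength_eq.symm
  exact ⟨hlen ▸ Module.length_ne_top, N, hMN, hlen⟩

theorem isMinimal_iff_barLength_eq (h0 : ∀ a ∈ 𝒜.gr 0, 𝒜.d a = 0) (hM : M.IsPerfect) :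
    M.IsMinimal ↔ M.barLength = M.barHLength :=
  ⟨IsMinimal.barLength_eq_barHLength,
    isMinimal_of_barLength_eq_barHLength (hM.exists_hotIso_barLength_eq h0).1⟩

theorem isMinimal_iff_barLength_le (h0 : ∀ a ∈ 𝒜.gr 0, 𝒜.d a = 0) (hM : M.IsPerfect) :
    M.IsMinimal ↔
      M.barLength ≠ ⊤ ∧ ∀ N : DGModule 𝒜, HotIso M N → M.barLength ≤ N.barLength := by
  obtain ⟨hfin, N, hMN, hlen⟩ := hM.exists_hotIso_barLength_eq h0
  rw [hM.isMinimal_iff_barLength_eq h0]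
  refine ⟨fun h => ⟨h ▸ hfin, fun P hP => ?_⟩, fun h => ?_⟩
  · rw [h, hP.barHLength_eq]
    exact P.barHLength_le_barLength
  · exact le_antisymm ((h.2 N hMN).trans_eq hlen) M.barHLength_le_barLength

theorem minimality_tfae (h0 : ∀ a ∈ 𝒜.gr 0, 𝒜.d a = 0) (hM : M.IsPerfect) : List.TFAE [
    ∀ i, ∀ m ∈ M.le i, M.d m ∈ M.le i,
    ∀ m, M.d m ∈ M.mulAPlus.toSubmodule,
    ∀ x, M.bar.d x = 0,
    M.barLength = M.barHLength,
    M.barLength ≠ ⊤ ∧ ∀ N : DGModule 𝒜, HotIso M N → M.barLength ≤ N.barLength] := by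
  have hle := isMinimal_iff_d_mem_le (M := M)
  have hAPlus : M.IsMinimal ↔ ∀ m, M.d m ∈ M.mulAPlus.toSubmodule :=
    forall_congr' fun _ => mem_mulAPlus.symm
  have hbar : M.IsMinimal ↔ ∀ x, M.bar.d x = 0 :=
    isMinimal_iff_barD_eq_zero.trans LinearMap.ext_iff
  have hlen := hM.isMinimal_iff_barLength_eq h0
  have hmin := hM.isMinimal_iff_barLength_le h0
  tfae_have 1 ↔ 2 := hle.symm.trans hAPlus
  tfae_have 2 ↔ 3 := hAPlus.symm.trans hbar
  tfae_have 3 ↔ 4 := hbar.symm.trans hlen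
  tfae_have 4 ↔ 5 := hlen.symm.trans hmin
  tfae_finish

end IsPerfect

end DGModule

theorem proposition7p2 {k : Type w} {A : Type u} [CommRing k] [Ring A] [Algebra k A]
    (𝒜 : DGAlgebra k A)
    (hpos : ∀ i < 0, 𝒜.gr i = ⊥)
    (hss : IsSemisimpleRing 𝒜.A0)
    (h0 : ∀ a ∈ 𝒜.gr 0, 𝒜.d a = 0)
    (M : DGModule 𝒜) (hM : M.IsPerfect) :
    -- the equivalence of all seven conditions, for bounded below `M`
    (M.IsBoundedBelow → List.TFAE [
      M.IsFilt h0,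
      M.IsHomotopicallyMinimal,
      ∀ i, ∀ m ∈ M.le i, M.d m ∈ M.le i,
      ∀ m, M.d m ∈ M.mulAPlus.toSubmodule,
      ∀ x, M.bar.d x = 0,
      M.barLength = M.barHLength,
      M.barLength ≠ ⊤ ∧ ∀ N : DGModule 𝒜, M.HotIso N → M.barLength ≤ N.barLength]) ∧
    -- what holds without any boundedness condition
    (M.IsFilt h0 ↔ M.IsHomotopicallyMinimal) ∧
    List.TFAE [
      ∀ i, ∀ m ∈ M.le i, M.d m ∈ M.le i,
      ∀ m, M.d m ∈ M.mulAPlus.toSubmodule,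
      ∀ x, M.bar.d x = 0,
      M.barLength = M.barHLength,
      M.barLength ≠ ⊤ ∧ ∀ N : DGModule 𝒜, M.HotIso N → M.barLength ≤ N.barLength] ∧
    (M.IsFilt h0 →
      M.IsBoundedBelow ∧ ∀ i, ∀ m ∈ M.le i, M.d m ∈ M.le i) := by
  have : 𝒜.IsNonneg := ⟨hpos⟩
  have h₁₂ : M.IsFilt h0 ↔ M.IsHomotopicallyMinimal := hM.isFilt_iff_isHomotopicallyMinimal
  have h₃₇ := hM.minimality_tfae h0
  have h₁₃ : M.IsFilt h0 → M.IsBoundedBelow ∧ ∀ i, ∀ m ∈ M.le i, M.d m ∈ M.le i :=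
    fun h => ⟨h.isBoundedBelow, DGModule.isMinimal_iff_d_mem_le.1 h.isMinimal⟩
  refine ⟨fun hb => ?_, h₁₂, h₃₇, h₁₃⟩
  have h₂₃ : M.IsHomotopicallyMinimal ↔ ∀ i, ∀ m ∈ M.le i, M.d m ∈ M.le i :=
    ⟨fun h => (h₁₃ (h₁₂.2 h)).2, fun h =>
      (DGModule.isMinimal_iff_d_mem_le.2 h).isHomotopicallyMinimal hb⟩
  exact (List.tfae_cons_of_mem (.head _)).2
    ⟨h₁₂, (List.tfae_cons_of_mem (.head _)).2 ⟨h₂₃, h₃₇⟩⟩
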